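/- Let $n\geq 1$ be an integer and let $q\in\mathbb{C}^{\times}$ be not a root of unity. Let $\mathcal{O}_q(M_n)$ be the unital associative $\mathbb{C}$-algebra with generators $x_{i,j}$ ($1\le i,j\le n$) and relations \[ x_{i,j}x_{k,l}=\begin{cases} x_{k,l}x_{i,j}+(q-q^{-1})\,x_{i,l}x_{k,j} & \text{if } i<k \text{ and } j<l,\\ q\,x_{k,l}x_{i,j} & \text{if } (i=k \text{ and } j<l) \text{ or } (j=l \text{ and } i<k),\\ x_{k,l}x_{i,j} & \text{if } i<k \text{ and } j>l. \end{cases} \] For subsets $I=\{i_1<\dots<i_t\}$ and $J=\{j_1<\dots<j_t\}$ of $\{1,\dots,n\}$ let \[ [I\,|\,J]=\sum_{s\in S_t}(-q)^{\ell(s)}x_{i_1,j_{s(1)}}x_{i_2,j_{s(2)}}\cdots x_{i_t,j_{s(t)}}, \] where $\ell(s)$ is the number of inversions of $s$. Let $\sigma_t=\sum_{|I|=t}[I\,|\,I]$ for $1\le t\le n$, so that $\sigma_1=x_{1,1}+\dots+x_{n,n}$ and $\sigma_n=\det_q:=[\{1,\dots,n\}\,|\,\{1,\dots,n\}]$. Let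 $\mathcal{O}_q(GL_n)=\mathcal{O}_q(M_n)[\det_q^{-1}]$ be the localization at $\det_q$, with the images of the $\sigma_t$ again denoted by $\sigma_t$, and let $\mathcal{O}_q(SL_n)=\mathcal{O}_q(M_n)/(\det_q-1)$, with $\overline{\sigma}_t$ the image of $\sigma_t$. Write $\mathbb{C}\langle\dots\rangle$ for the generated unital $\mathbb{C}$-subalgebra. Then the following are equivalent: \begin{enumerate} \item The centralizer of $\sigma_1$ in $\mathcal{O}_q(M_n)$ is $\mathbb{C}\langle\sigma_1,\dots,\sigma_n\rangle$. \item The centralizer of $\sigma_1$ in $\mathcal{O}_q(GL_n)$ is $\mathbb{C}\langle\sigma_1,\dots,\sigma_n,\sigma_n^{-1}\rangle$. \item The centralizer of $\overline{\sigma}_1$ in $\mathcal{O}_q(SL_n)$ is $\mathbb{C}\langle\overline{\sigma}_1,\dots,\overline{\sigma}_{n-1}\rangle$. \end{enumerate} -/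

import Mathlib

noncomputable section

namespace QuantumMatrices

/-- The Coxeter length of a permutation: its number of inversions. -/
def permLength {t : ℕ} (s : Equiv.Perm (Fin t)) : ℕ :=
  (Finset.univ.filter fun p : Fin t × Fin t => p.1 < p.2 ∧ s p.2 < s p.1).card

/-- The expression `∑ₛ (-q)^ℓ(s) X₁,ₛ₍₁₎ X₂,ₛ₍₂₎ ⋯ Xₜ,ₛ₍ₜ₎`, with the products taken in this order,
for a square array `X` of elements of a `ℂ`-algebra. -/
def qDet {A : Type*} [Ring A] [Algebra ℂ A] (q : ℂ) {t : ℕ} (X : Matrix (Fin t) (Fin t) A) : A :=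
  ∑ s : Equiv.Perm (Fin t), (-q) ^ permLength s • (List.ofFn fun a => X a (s a)).prod

/-- The quantum minor `[I | J]`; rows and columns are listed in increasing order. -/
def qMinor {A : Type*} [Ring A] [Algebra ℂ A] (q : ℂ) {n t : ℕ} (X : Matrix (Fin n) (Fin n) A)
    (I J : Finset (Fin n)) (hI : I.card = t) (hJ : J.card = t) : A :=
  qDet q (X.submatrix (I.orderEmbOfFin hI) (J.orderEmbOfFin hJ))

/-- The sum of the principal quantum minors of size `t`. -/
def qSigma {A : Type*} [Ring A] [Algebra ℂ A] (q : ℂ) {n : ℕ} (X : Matrix (Fin n) (Fin n) A)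
    (t : ℕ) : A :=
  ∑ I : {I : Finset (Fin n) // I.card = t}, qMinor q X I.1 I.1 I.2 I.2

/-- The free generators, as a matrix. -/
def freeX (n : ℕ) : Matrix (Fin n) (Fin n) (FreeAlgebra ℂ (Fin n × Fin n)) :=
  fun i j => FreeAlgebra.ι ℂ (i, j)

/-- The defining relations of the quantized coordinate ring of `n × n` matrices. -/
inductive MRel (n : ℕ) (q : ℂ) :
    FreeAlgebra ℂ (Fin n × Fin n) → FreeAlgebra ℂ (Fin n × Fin n) → Prop
  | diag (i j k l : Fin n) (hik : i < k) (hjl : j < l) :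
      MRel n q (freeX n i j * freeX n k l)
        (freeX n k l * freeX n i j + (q - q⁻¹) • (freeX n i l * freeX n k j))
  | row (i j l : Fin n) (hjl : j < l) :
      MRel n q (freeX n i j * freeX n i l) (q • (freeX n i l * freeX n i j))
  | col (i j k : Fin n) (hik : i < k) :
      MRel n q (freeX n i j * freeX n k j) (q • (freeX n k j * freeX n i j))
  | anti (i j k l : Fin n) (hik : i < k) (hlj : l < j) :
      MRel n q (freeX n i j * freeX n k l) (freeX n k l * freeX n i j)

/-- The quantized coordinate ring of `n × n` matrices. -/
def OqM (n : ℕ) (q : ℂ) : Type := RingQuot (MRel n q)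

instance (n : ℕ) (q : ℂ) : Ring (OqM n q) := inferInstanceAs (Ring (RingQuot (MRel n q)))

instance (n : ℕ) (q : ℂ) : Algebra ℂ (OqM n q) :=
  inferInstanceAs (Algebra ℂ (RingQuot (MRel n q)))

/-- The projection from the free algebra. -/
def mkM (n : ℕ) (q : ℂ) : FreeAlgebra ℂ (Fin n × Fin n) →ₐ[ℂ] OqM n q :=
  RingQuot.mkAlgHom ℂ (MRel n q)

theorem mkM_rel (n : ℕ) (q : ℂ) ⦃a b : FreeAlgebra ℂ (Fin n × Fin n)⦄
    (h : MRel n q a b) : mkM n q a = mkM n q b :=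
  RingQuot.mkAlgHom_rel ℂ h

/-- Homomorphisms out of `OqM n q` from homomorphisms that respect the relations. -/
def liftM {n : ℕ} {q : ℂ} {B : Type*} [Ring B] [Algebra ℂ B]
    (F : FreeAlgebra ℂ (Fin n × Fin n) →ₐ[ℂ] B)
    (hF : ∀ ⦃a b⦄, MRel n q a b → F a = F b) : OqM n q →ₐ[ℂ] B :=
  RingQuot.liftAlgHom ℂ ⟨F, hF⟩

theorem liftM_mk {n : ℕ} {q : ℂ} {B : Type*} [Ring B] [Algebra ℂ B]
    (F : FreeAlgebra ℂ (Fin n × Fin n) →ₐ[ℂ] B)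
    (hF : ∀ ⦃a b⦄, MRel n q a b → F a = F b) (a : FreeAlgebra ℂ (Fin n × Fin n)) :
    liftM F hF (mkM n q a) = F a :=
  RingQuot.liftAlgHom_mkAlgHom_apply ℂ F hF a

theorem mkM_surjective (n : ℕ) (q : ℂ) : Function.Surjective (mkM n q) :=
  RingQuot.mkAlgHom_surjective ℂ (MRel n q)

/-- The matrix of generators `x i j` of `OqM n q`. -/
def genX (n : ℕ) (q : ℂ) : Matrix (Fin n) (Fin n) (OqM n q) :=
  fun i j => mkM n q (freeX n i j)

/-- The quantum determinant in `OqM n q`. -/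
def detM (n : ℕ) (q : ℂ) : OqM n q := qDet q (genX n q)

/-- The element `σ_t` of `OqM n q`. -/
def sigmaM (n : ℕ) (q : ℂ) (t : ℕ) : OqM n q := qSigma q (genX n q) t

/-- The quantized coordinate ring of `SL_n`: the quotient by the two-sided ideal `(det_q - 1)`. -/
abbrev OqSL (n : ℕ) (q : ℂ) : Type :=
  (TwoSidedIdeal.span {detM n q - 1}).ringCon.Quotient

/-- The quotient map onto `OqSL n q`. -/
def toSL (n : ℕ) (q : ℂ) : OqM n q →ₐ[ℂ] OqSL n q :=
  (TwoSidedIdeal.span {detM n q - 1}).ringCon.mkₐ (α := ℂ)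

/-- The embedding of free algebras that adds the free generator `none`. -/
def freeIncl (n : ℕ) :
    FreeAlgebra ℂ (Fin n × Fin n) →ₐ[ℂ] FreeAlgebra ℂ (Option (Fin n × Fin n)) :=
  FreeAlgebra.lift ℂ fun p => FreeAlgebra.ι ℂ (some p)

/-- The relations of `OqM n q`, together with those saying that the extra generator is a two-sided
inverse of the quantum determinant. -/
inductive GLRel (n : ℕ) (q : ℂ) : FreeAlgebra ℂ (Option (Fin n × Fin n)) →
    FreeAlgebra ℂ (Option (Fin n × Fin n)) → Prop
  | ofM (a b : FreeAlgebra ℂ (Fin n × Fin n)) (h : MRel n q a b) :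
      GLRel n q (freeIncl n a) (freeIncl n b)
  | det_mul_inv : GLRel n q (freeIncl n (qDet q (freeX n)) * FreeAlgebra.ι ℂ none) 1
  | inv_mul_det : GLRel n q (FreeAlgebra.ι ℂ none * freeIncl n (qDet q (freeX n))) 1

/-- The quantized coordinate ring of `GL_n`: the localization of `OqM n q` at the quantum
determinant, obtained by freely adjoining a two-sided inverse (see `existsUnique_lift_GL`). -/
def OqGL (n : ℕ) (q : ℂ) : Type := RingQuot (GLRel n q)

instance (n : ℕ) (q : ℂ) : Ring (OqGL n q) := inferInstanceAs (Ring (RingQuot (GLRel n q)))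

instance (n : ℕ) (q : ℂ) : Algebra ℂ (OqGL n q) :=
  inferInstanceAs (Algebra ℂ (RingQuot (GLRel n q)))

/-- The projection from the free algebra. -/
def mkGL (n : ℕ) (q : ℂ) : FreeAlgebra ℂ (Option (Fin n × Fin n)) →ₐ[ℂ] OqGL n q :=
  RingQuot.mkAlgHom ℂ (GLRel n q)

theorem mkGL_rel (n : ℕ) (q : ℂ) ⦃a b : FreeAlgebra ℂ (Option (Fin n × Fin n))⦄
    (h : GLRel n q a b) : mkGL n q a = mkGL n q b :=
  RingQuot.mkAlgHom_rel ℂ h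

/-- Homomorphisms out of `OqGL n q` from homomorphisms that respect the relations. -/
def liftGL {n : ℕ} {q : ℂ} {B : Type*} [Ring B] [Algebra ℂ B]
    (F : FreeAlgebra ℂ (Option (Fin n × Fin n)) →ₐ[ℂ] B)
    (hF : ∀ ⦃a b⦄, GLRel n q a b → F a = F b) : OqGL n q →ₐ[ℂ] B :=
  RingQuot.liftAlgHom ℂ ⟨F, hF⟩

theorem liftGL_mk {n : ℕ} {q : ℂ} {B : Type*} [Ring B] [Algebra ℂ B]
    (F : FreeAlgebra ℂ (Option (Fin n × Fin n)) →ₐ[ℂ] B)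
    (hF : ∀ ⦃a b⦄, GLRel n q a b → F a = F b) (a : FreeAlgebra ℂ (Option (Fin n × Fin n))) :
    liftGL F hF (mkGL n q a) = F a :=
  RingQuot.liftAlgHom_mkAlgHom_apply ℂ F hF a

theorem mkGL_surjective (n : ℕ) (q : ℂ) : Function.Surjective (mkGL n q) :=
  RingQuot.mkAlgHom_surjective ℂ (GLRel n q)

/-- The canonical map from `OqM n q` to its localization. -/
def toGL (n : ℕ) (q : ℂ) : OqM n q →ₐ[ℂ] OqGL n q :=
  liftM ((mkGL n q).comp (freeIncl n)) fun _ _ h => mkGL_rel n q (GLRel.ofM _ _ h)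

theorem toGL_mkM (n : ℕ) (q : ℂ) (a : FreeAlgebra ℂ (Fin n × Fin n)) :
    toGL n q (mkM n q a) = mkGL n q (freeIncl n a) :=
  liftM_mk _ _ a

/-- The element `det_q⁻¹ = σ_n⁻¹` of `OqGL n q`. -/
def detInv (n : ℕ) (q : ℂ) : OqGL n q :=
  mkGL n q (FreeAlgebra.ι ℂ none)

theorem map_qDet {A B : Type*} [Ring A] [Algebra ℂ A] [Ring B] [Algebra ℂ B] (f : A →ₐ[ℂ] B)
    (q : ℂ) {t : ℕ} (X : Matrix (Fin t) (Fin t) A) :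
    f (qDet q X) = qDet q (fun i j => f (X i j)) := by
  simp [qDet, map_list_prod, List.map_ofFn, Function.comp_def]

theorem mk_qDet_freeX (n : ℕ) (q : ℂ) :
    mkM n q (qDet q (freeX n)) = detM n q :=
  map_qDet _ q _

theorem toGL_detM (n : ℕ) (q : ℂ) :
    toGL n q (detM n q) =
      mkGL n q (freeIncl n (qDet q (freeX n))) := by
  rw [← mk_qDet_freeX, toGL_mkM]

theorem toGL_detM_mul_detInv (n : ℕ) (q : ℂ) : toGL n q (detM n q) * detInv n q = 1 := by
  rw [toGL_detM, detInv, ← map_mul, mkGL_rel n q GLRel.det_mul_inv, map_one]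

theorem detInv_mul_toGL_detM (n : ℕ) (q : ℂ) : detInv n q * toGL n q (detM n q) = 1 := by
  rw [toGL_detM, detInv, ← map_mul, mkGL_rel n q GLRel.inv_mul_det, map_one]

theorem sigmaM_self (n : ℕ) (q : ℂ) : sigmaM n q n = detM n q := by
  have hu : ∀ I : {I : Finset (Fin n) // I.card = n}, I = ⟨Finset.univ, by simp⟩ := by
    rintro ⟨I, hI⟩
    exact Subtype.ext (Finset.eq_univ_of_card I (by simpa using hI))
  let _ : Unique {I : Finset (Fin n) // I.card = n} := ⟨⟨⟨Finset.univ, by simp⟩⟩, hu⟩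
  have he : ∀ h : (Finset.univ : Finset (Fin n)).card = n,
      ⇑((Finset.univ : Finset (Fin n)).orderEmbOfFin h) = id := by
    intro h
    exact (Finset.orderEmbOfFin_unique h (by simp) strictMono_id).symm
  rw [sigmaM, qSigma, Fintype.sum_unique, hu default]
  simp only [qMinor, he]
  rfl

/-- The universal property of the localization. -/
theorem existsUnique_lift_GL (n : ℕ) (q : ℂ) {B : Type*} [Ring B] [Algebra ℂ B]
    (f : OqM n q →ₐ[ℂ] B) (hf : IsUnit (f (detM n q))) :
    ∃! g : OqGL n q →ₐ[ℂ] B, g.comp (toGL n q) = f := by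
  obtain ⟨u, hu⟩ := hf
  let F : FreeAlgebra ℂ (Option (Fin n × Fin n)) →ₐ[ℂ] B :=
    FreeAlgebra.lift ℂ fun o => o.elim (↑u⁻¹ : B) fun p => f (genX n q p.1 p.2)
  have hF : F.comp (freeIncl n) = f.comp (mkM n q) := by
    ext p
    simp [F, freeIncl, genX, freeX]
  have hF' : ∀ a, F (freeIncl n a) = f (mkM n q a) :=
    fun a => DFunLike.congr_fun hF a
  have hN : F (FreeAlgebra.ι ℂ none) = ↑u⁻¹ := by simp [F]
  have hR : ∀ ⦃a b⦄, GLRel n q a b → F a = F b := by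
    rintro _ _ (⟨a, b, h⟩ | _ | _)
    · rw [hF', hF', mkM_rel n q h]
    · rw [map_mul, hF', hN, mk_qDet_freeX, ← hu, map_one, Units.mul_inv]
    · rw [map_mul, hF', hN, mk_qDet_freeX, ← hu, map_one, Units.inv_mul]
  refine ⟨liftGL F hR, ?_, ?_⟩
  · ext y
    obtain ⟨a, rfl⟩ := mkM_surjective n q y
    rw [AlgHom.comp_apply, toGL_mkM, liftGL_mk, hF']
  · intro g hg
    have hg' : g.comp (mkGL n q) = F := by
      ext o
      simp only [AlgHom.comp_apply, Function.comp_apply]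
      cases o with
      | none =>
        rw [hN]
        have h1 : g (detInv n q) * ↑u = 1 := by
          rw [hu, ← hg, AlgHom.comp_apply, ← map_mul, detInv_mul_toGL_detM, map_one]
        exact (Units.mul_eq_one_iff_eq_inv).1 h1
      | some p =>
        have h2 : freeIncl n (FreeAlgebra.ι ℂ p) = FreeAlgebra.ι ℂ (some p) := by simp [freeIncl]
        rw [← h2, hF', ← hg, AlgHom.comp_apply, toGL_mkM]
    ext y
    obtain ⟨a, rfl⟩ := mkGL_surjective n q y
    rw [liftGL_mk, ← hg', AlgHom.comp_apply]

end QuantumMatrices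

end

/-!
The quantum determinant is central and `OqM n q` is a domain, being an iterated Ore extension of
`ℂ` by the matrix entries.

Restriction to the diagonal torus, `x i j ↦ δᵢⱼ xᵢ`, maps `σ₁, …, σₙ` to the elementary symmetric
polynomials, and it is injective on the centralizer of `σ₁`. Indeed, let `a ≠ 0` commute with `σ₁`
and write `OqM (n + 1) q` as an Ore extension `R[x₀₀; τ, δ]`. Comparing top coefficients shows that
`τ` fixes the leading coefficient of `a`. As `τ` multiplies the other entries of the first row and
column by `q`, which is not a root of unity, and fixes the remaining ones, the leading coefficient
belongs to the copy of `OqM n q` formed by the latter. Hence it survives in the restriction of `a`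
to block diagonal matrices, where it again commutes with `σ₁`, and induction applies.

Therefore the centralizer of `σ₁` is `ℂ⟨σ₁, …, σₙ⟩` if and only if the `σᵢ` commute with `σ₁` and
every element of the centralizer restricts to a symmetric polynomial. These two conditions pass to
and from the localization because `det_q` is central and regular. They pass to and from the quotient
because `det_q - 1` has components of degrees `0` and `n` only: an element whose degrees lie in a
window of length `n` is determined by its image, and every element of the quotient has such a lift.
-/

noncomputable section

namespace QuantumMatrices

/-! ### Permutations and the quantum determinant -/

/-- The permutation of `Fin (t + 1)` that sends `p` to `j` and is order-isomorphic to `s` on the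
complements; it indexes the terms of the Laplace expansions. -/
def permInsert {t : ℕ} (p j : Fin (t + 1)) (s : Equiv.Perm (Fin t)) : Equiv.Perm (Fin (t + 1)) :=
  (finSuccEquiv' p).trans ((Equiv.optionCongr s).trans (finSuccEquiv' j).symm)

@[simp]
theorem permInsert_self {t : ℕ} (p j : Fin (t + 1)) (s : Equiv.Perm (Fin t)) :
    permInsert p j s p = j := by
  simp [permInsert]

@[simp]
theorem permInsert_succAbove {t : ℕ} (p j : Fin (t + 1)) (s : Equiv.Perm (Fin t)) (a : Fin t) :
    permInsert p j s (p.succAbove a) = j.succAbove (s a) := by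
  simp [permInsert]

@[simp]
theorem permInsert_zero_succ {t : ℕ} (j : Fin (t + 1)) (s : Equiv.Perm (Fin t)) (a : Fin t) :
    permInsert 0 j s a.succ = j.succAbove (s a) := by
  simpa using permInsert_succAbove 0 j s a

theorem permInsert_inv {t : ℕ} (p j : Fin (t + 1)) (s : Equiv.Perm (Fin t)) :
    (permInsert p j s)⁻¹ = permInsert j p s⁻¹ :=
  rfl

theorem permInsert_bijective {t : ℕ} (p : Fin (t + 1)) :
    Function.Bijective fun x : Fin (t + 1) × Equiv.Perm (Fin t) => permInsert p x.1 x.2 := by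
  rw [Fintype.bijective_iff_injective_and_card]
  constructor
  · rintro ⟨j, s⟩ ⟨j', s'⟩ h
    have hj : j = j' := by simpa using DFunLike.congr_fun h p
    subst hj
    refine Prod.ext rfl (Equiv.ext fun a => ?_)
    simpa using DFunLike.congr_fun h (p.succAbove a)
  · simp [Fintype.card_perm, Nat.factorial_succ]

theorem permInsert_bijective_left {t : ℕ} (j : Fin (t + 1)) :
    Function.Bijective fun x : Fin (t + 1) × Equiv.Perm (Fin t) => permInsert x.1 j x.2 :=
  (Equiv.inv _).bijective.comp
    ((permInsert_bijective j).comp (Equiv.prodCongr (.refl _) (.inv _)).bijective)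

theorem permLength_eq_sum {t : ℕ} (s : Equiv.Perm (Fin t)) :
    permLength s = ∑ a, ∑ b, if a < b ∧ s b < s a then 1 else 0 := by
  rw [permLength, Finset.card_filter, Fintype.sum_prod_type]

theorem permLength_inv {t : ℕ} (s : Equiv.Perm (Fin t)) : permLength s⁻¹ = permLength s := by
  rw [permLength_eq_sum, permLength_eq_sum, Finset.sum_comm, ← Equiv.sum_comp s]
  refine Finset.sum_congr rfl fun a _ => ?_
  rw [← Equiv.sum_comp s]
  simp [and_comm]

theorem permLength_revPerm_conj {t : ℕ} (s : Equiv.Perm (Fin t)) :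
    permLength (Fin.revPerm.permCongr s) = permLength s := by
  rw [permLength_eq_sum, permLength_eq_sum, Finset.sum_comm, ← Equiv.sum_comp Fin.revPerm]
  refine Finset.sum_congr rfl fun a _ => ?_
  rw [← Equiv.sum_comp Fin.revPerm]
  simp

theorem sum_succAbove_lt {t : ℕ} (j : Fin (t + 1)) :
    (∑ c : Fin t, if j.succAbove c < j then 1 else 0) = (j : ℕ) := by
  have h := Finset.card_filter (fun c : Fin (t + 1) => c < j) Finset.univ
  rw [Fin.sum_univ_succAbove _ j] at h
  simp only [lt_irrefl, if_false, zero_add] at h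
  rw [← h, Finset.filter_gt_eq_Iio, Fin.card_Iio]

theorem permLength_permInsert_zero {t : ℕ} (j : Fin (t + 1)) (s : Equiv.Perm (Fin t)) :
    permLength (permInsert 0 j s) = j + permLength s := by
  rw [permLength_eq_sum, Fin.sum_univ_succ]
  simp only [Fin.sum_univ_succ (n := t), permInsert_self, permInsert_zero_succ, lt_irrefl,
    Fin.succ_pos, Fin.not_lt_zero, false_and, true_and, if_false, zero_add, Fin.succ_lt_succ_iff,
    Fin.succAbove_lt_succAbove_iff]
  rw [Equiv.sum_comp s (fun c => if j.succAbove c < j then 1 else 0), sum_succAbove_lt,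
    ← permLength_eq_sum]

theorem permLength_permInsert_left_zero {t : ℕ} (k : Fin (t + 1)) (s : Equiv.Perm (Fin t)) :
    permLength (permInsert k 0 s) = k + permLength s := by
  rw [← permLength_inv, permInsert_inv, permLength_permInsert_zero, permLength_inv]

section Reordering

variable {E : Type*} [Ring E] [Algebra ℂ E] {c : ℂ}

theorem mul_prod_ofFn_succAbove {t : ℕ} (Ω : Fin (t + 1) → E) (k : Fin (t + 1))
    (h : ∀ i < k, Ω k * Ω i = c • (Ω i * Ω k)) :
    Ω k * (List.ofFn fun a => Ω (k.succAbove a)).prod = c ^ (k : ℕ) • (List.ofFn Ω).prod := by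
  induction t with
  | zero => simp [Fin.fin_one_eq_zero k]
  | succ t ih =>
    cases k using Fin.cases with
    | zero => simp
    | succ k =>
      have hk := ih (fun a => Ω a.succ) k fun i hi => h _ (Fin.succ_lt_succ_iff.2 hi)
      rw [List.ofFn_succ, List.prod_cons, List.ofFn_succ, List.prod_cons, Fin.succ_succAbove_zero,
        ← mul_assoc, h 0 (Fin.succ_pos k), smul_mul_assoc, mul_assoc]
      simp only [Fin.succ_succAbove_succ]
      rw [hk, mul_smul_comm, smul_smul, Fin.val_succ, pow_succ']

theorem mul_prod_ofFn_eq_zero {t : ℕ} (Ω : Fin t → E) (k : Fin t) (hk : Ω k * Ω k = 0)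
    (h : ∀ i < k, Ω k * Ω i = c • (Ω i * Ω k)) : Ω k * (List.ofFn Ω).prod = 0 := by
  induction t with
  | zero => exact k.elim0
  | succ t ih =>
    rw [List.ofFn_succ, List.prod_cons]
    cases k using Fin.cases with
    | zero => rw [← mul_assoc, hk, zero_mul]
    | succ k =>
      rw [← mul_assoc, h 0 (Fin.succ_pos k), smul_mul_assoc, mul_assoc,
        ih (fun a => Ω a.succ) k hk fun i hi => h _ (Fin.succ_lt_succ_iff.2 hi), mul_zero,
        smul_zero]

end Reordering

theorem qDet_succ_row_zero {A : Type*} [Ring A] [Algebra ℂ A] (q : ℂ) {t : ℕ}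
    (X : Matrix (Fin (t + 1)) (Fin (t + 1)) A) :
    qDet q X = ∑ j : Fin (t + 1),
      (-q) ^ (j : ℕ) • (X 0 j * qDet q (X.submatrix Fin.succ j.succAbove)) := by
  rw [qDet, ← (permInsert_bijective (0 : Fin (t + 1))).sum_comp, Fintype.sum_prod_type]
  refine Finset.sum_congr rfl fun j _ => ?_
  rw [qDet, Finset.mul_sum, Finset.smul_sum]
  refine Finset.sum_congr rfl fun s _ => ?_
  simp [permLength_permInsert_zero, List.ofFn_succ, pow_add, mul_smul]

/-- The relations between the entries of a (rectangular) quantum matrix, as between the generators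
of `OqM n q`. -/
structure IsQMatrix (q : ℂ) {A : Type*} [Ring A] [Algebra ℂ A] {m n : ℕ}
    (X : Matrix (Fin m) (Fin n) A) : Prop where
  diag : ∀ ⦃i j k l⦄, i < k → j < l →
    X i j * X k l = X k l * X i j + (q - q⁻¹) • (X i l * X k j)
  row : ∀ ⦃i j l⦄, j < l → X i j * X i l = q • (X i l * X i j)
  col : ∀ ⦃i j k⦄, i < k → X i j * X k j = q • (X k j * X i j)
  anti : ∀ ⦃i j k l⦄, i < k → l < j → X i j * X k l = X k l * X i j

theorem isQMatrix_genX (n : ℕ) (q : ℂ) : IsQMatrix q (genX n q) where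
  diag i j k l h h' := by simpa [genX] using mkM_rel n q (MRel.diag i j k l h h')
  row i j l h := by simpa [genX] using mkM_rel n q (MRel.row i j l h)
  col i j k h := by simpa [genX] using mkM_rel n q (MRel.col i j k h)
  anti i j k l h h' := by simpa [genX] using mkM_rel n q (MRel.anti i j k l h h')

namespace IsQMatrix

variable {A : Type*} [Ring A] [Algebra ℂ A] {q : ℂ}

section Rectangular

variable {m n : ℕ} {X : Matrix (Fin m) (Fin n) A}

theorem transpose (h : IsQMatrix q X) : IsQMatrix q X.transpose where
  diag _ _ _ _ hik hjl := by
    simp only [Matrix.transpose_apply]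
    rw [h.diag hjl hik, h.anti hjl hik]
  row _ _ _ hjl := h.col hjl
  col _ _ _ hik := h.row hik
  anti _ _ _ _ hik hlj := (h.anti hlj hik).symm

theorem submatrix (h : IsQMatrix q X) {m' n' : ℕ} {f : Fin m' → Fin m} {g : Fin n' → Fin n}
    (hf : StrictMono f) (hg : StrictMono g) : IsQMatrix q (X.submatrix f g) where
  diag _ _ _ _ hik hjl := h.diag (hf hik) (hg hjl)
  row _ _ _ hjl := h.row (hg hjl)
  col _ _ _ hik := h.col (hf hik)
  anti _ _ _ _ hik hlj := h.anti (hf hik) (hg hlj)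

/-- Reversing the order of the rows and of the columns compensates for reversing products. -/
theorem op_rev (h : IsQMatrix q X) :
    IsQMatrix q (Matrix.of fun i j => MulOpposite.op (X i.rev j.rev)) where
  diag _ _ _ _ hik hjl := by
    simp only [Matrix.of_apply, ← MulOpposite.op_mul, ← MulOpposite.op_smul, ← MulOpposite.op_add]
    rw [h.diag (Fin.rev_lt_rev.2 hik) (Fin.rev_lt_rev.2 hjl),
      h.anti (Fin.rev_lt_rev.2 hik) (Fin.rev_lt_rev.2 hjl)]
  row _ _ _ hjl := congrArg MulOpposite.op (h.row (Fin.rev_lt_rev.2 hjl))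
  col _ _ _ hik := congrArg MulOpposite.op (h.col (Fin.rev_lt_rev.2 hik))
  anti _ _ _ _ hik hlj :=
    congrArg MulOpposite.op (h.anti (Fin.rev_lt_rev.2 hik) (Fin.rev_lt_rev.2 hlj))

end Rectangular

theorem qDet_succ_col_zero {t : ℕ} {X : Matrix (Fin (t + 1)) (Fin (t + 1)) A}
    (h : IsQMatrix q X) :
    qDet q X = ∑ k : Fin (t + 1),
      (-q) ^ (k : ℕ) • (X k 0 * qDet q (X.submatrix k.succAbove Fin.succ)) := by
  rw [qDet, ← (permInsert_bijective_left (0 : Fin (t + 1))).sum_comp, Fintype.sum_prod_type]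
  refine Finset.sum_congr rfl fun k _ => ?_
  rw [qDet, Finset.mul_sum, Finset.smul_sum]
  refine Finset.sum_congr rfl fun s _ => ?_
  have hmove : X k 0 * (List.ofFn fun a => X (k.succAbove a) (s a).succ).prod =
      (List.ofFn fun a => X a (permInsert k 0 s a)).prod := by
    have := mul_prod_ofFn_succAbove (c := 1) (fun a => X a (permInsert k 0 s a)) k fun i hi => by
      obtain ⟨a, rfl⟩ := Fin.exists_succAbove_eq hi.ne
      simpa using (h.anti hi (Fin.succ_pos (s a))).symm
    simpa using this
  rw [permLength_permInsert_left_zero, pow_add, mul_smul, mul_smul_comm, ← hmove]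
  rfl

theorem qDet_transpose {n : ℕ} {X : Matrix (Fin n) (Fin n) A} (h : IsQMatrix q X) :
    qDet q X.transpose = qDet q X := by
  induction n with
  | zero => rw [Subsingleton.elim X.transpose X]
  | succ n ih =>
    rw [qDet_succ_row_zero, h.qDet_succ_col_zero]
    refine Finset.sum_congr rfl fun k _ => ?_
    rw [← Matrix.transpose_submatrix,
      ih (h.submatrix (Fin.strictMono_succAbove k) Fin.strictMono_succ), Matrix.transpose_apply]

end IsQMatrix

theorem qDet_op_rev {A : Type*} [Ring A] [Algebra ℂ A] (q : ℂ) {t : ℕ}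
    (X : Matrix (Fin t) (Fin t) A) :
    qDet q (Matrix.of fun i j => MulOpposite.op (X i.rev j.rev)) = MulOpposite.op (qDet q X) := by
  rw [qDet, qDet, Finset.op_sum, ← Equiv.sum_comp (Equiv.permCongr Fin.revPerm)]
  refine Finset.sum_congr rfl fun s _ => ?_
  rw [permLength_revPerm_conj, MulOpposite.op_smul, MulOpposite.op_list_prod, List.ofFn_eq_map,
    List.ofFn_eq_map, ← List.map_reverse, ← List.map_reverse, List.finRange_reverse]
  simp [Function.comp_def]

section Wedge

variable {A : Type*} [Ring A] [Algebra ℂ A]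

/-- Left multiplication by `∑ⱼ vⱼ ξⱼ` on the quantum exterior algebra over `A`, whose generators
satisfy `ξⱼ ξᵢ = -q ξᵢ ξⱼ` for `i < j`; elements are given by their coefficients. -/
def wedge (q : ℂ) {n : ℕ} (v : Fin n → A) : Module.End ℂ (Finset (Fin n) → A) where
  toFun m S := ∑ j ∈ S, (-q) ^ (S.filter (· < j)).card • (v j * m (S.erase j))
  map_add' m m' := by
    ext S
    simp [mul_add, Finset.sum_add_distrib]
  map_smul' c m := by
    ext S
    simp only [Pi.smul_apply, RingHom.id_apply, Finset.smul_sum, mul_smul_comm]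
    exact Finset.sum_congr rfl fun _ _ => smul_comm _ _ _

theorem wedge_apply (q : ℂ) {n : ℕ} (v : Fin n → A) (m : Finset (Fin n) → A)
    (S : Finset (Fin n)) :
    wedge q v m S = ∑ j ∈ S, (-q) ^ (S.filter (· < j)).card • (v j * m (S.erase j)) := rfl

theorem sum_sum_ne_eq_sum_sum_lt {ι M : Type*} [LinearOrder ι] [AddCommMonoid M] (S : Finset ι)
    (F : ι → ι → M) :
    (∑ j ∈ S, ∑ l ∈ S, if l ≠ j then F j l else 0) =
      ∑ j ∈ S, ∑ l ∈ S, if j < l then F j l + F l j else 0 := by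
  have hsplit : ∀ j l, (if l ≠ j then F j l else 0) =
      (if j < l then F j l else 0) + if l < j then F j l else 0 := by
    intro j l
    rcases lt_trichotomy j l with h | h | h
    · simp [h, h.ne', h.not_gt]
    · simp [h]
    · simp [h, h.ne, h.not_gt]
  have hswap : (∑ j ∈ S, ∑ l ∈ S, if l < j then F j l else 0) =
      ∑ j ∈ S, ∑ l ∈ S, if j < l then F l j else 0 := Finset.sum_comm
  simp only [hsplit, Finset.sum_add_distrib, hswap]
  simp only [← Finset.sum_add_distrib, ← ite_add_zero]

theorem wedge_wedge_apply (q : ℂ) {n : ℕ} (v w : Fin n → A) (m : Finset (Fin n) → A)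
    (S : Finset (Fin n)) :
    wedge q v (wedge q w m) S = ∑ j ∈ S, ∑ l ∈ S, if j < l then
      (-q) ^ ((S.filter (· < j)).card + ((S.erase j).filter (· < l)).card) •
        ((v j * w l - q • (v l * w j)) * m ((S.erase j).erase l)) else 0 := by
  have hexpand : wedge q v (wedge q w m) S = ∑ j ∈ S, ∑ l ∈ S, if l ≠ j then
      (-q) ^ ((S.filter (· < j)).card + ((S.erase j).filter (· < l)).card) •
        (v j * w l * m ((S.erase j).erase l)) else 0 := by
    rw [wedge_apply]
    refine Finset.sum_congr rfl fun j _ => ?_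
    rw [wedge_apply, Finset.mul_sum, Finset.smul_sum, ← Finset.sum_filter, Finset.filter_ne']
    refine Finset.sum_congr rfl fun l _ => ?_
    rw [pow_add, mul_smul, mul_smul_comm, mul_assoc]
  rw [hexpand, sum_sum_ne_eq_sum_sum_lt S]
  refine Finset.sum_congr rfl fun j hj => Finset.sum_congr rfl fun l _ => ?_
  refine ite_congr rfl (fun hjl => ?_) fun _ => rfl
  have hcard_j : (S.erase l).filter (· < j) = S.filter (· < j) := by
    rw [Finset.filter_erase, Finset.erase_eq_of_notMem (by simp [hjl.not_gt])]
  have hcard_l : (S.filter (· < l)).card = ((S.erase j).filter (· < l)).card + 1 := by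
    rw [Finset.filter_erase, Finset.card_erase_add_one (by simp [hj, hjl])]
  rw [hcard_j, hcard_l, Finset.erase_right_comm (a := l) (b := j), sub_mul, smul_sub,
    smul_mul_assoc, smul_smul, sub_eq_add_neg, ← neg_smul]
  congr 2
  ring

theorem prod_wedge_apply (q : ℂ) {n t : ℕ} (V : Fin t → Fin n → A) (c : Fin t → Fin n)
    (hc : StrictMono c) :
    ((List.ofFn fun a => wedge q (V a)).prod (Pi.single ∅ 1)) (Finset.univ.image c) =
      qDet q (Matrix.of fun a b => V a (c b)) := by
  induction t with
  | zero => simp [qDet, permLength]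
  | succ t ih =>
    rw [List.ofFn_succ, List.prod_cons, Module.End.mul_apply, wedge_apply,
      Finset.sum_image hc.injective.injOn, qDet_succ_row_zero]
    refine Finset.sum_congr rfl fun j _ => ?_
    have hset : (Finset.univ.image c).erase (c j) = Finset.univ.image (c ∘ j.succAbove) := by
      rw [← Finset.image_image, Fin.image_succAbove_univ, ← Finset.image_erase hc.injective]
      congr 1
      ext; simp
    have hcard : ((Finset.univ.image c).filter (· < c j)).card = j := by
      rw [Finset.filter_image, Finset.card_image_of_injective _ hc.injective]
      simp [hc.lt_iff_lt, Finset.filter_gt_eq_Iio]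
    rw [hset, hcard, ih _ _ (hc.comp (Fin.strictMono_succAbove j))]
    rfl

theorem prod_wedge_apply_univ (q : ℂ) {n : ℕ} (X : Matrix (Fin n) (Fin n) A) :
    (List.ofFn fun a => wedge q (X a)).prod (Pi.single ∅ 1) Finset.univ = qDet q X := by
  have := prod_wedge_apply q X id strictMono_id
  rwa [Finset.image_id] at this

end Wedge

namespace IsQMatrix

variable {A : Type*} [Ring A] [Algebra ℂ A] {q : ℂ}

section Wedge

variable {m n : ℕ} {X : Matrix (Fin m) (Fin n) A}

theorem wedge_mul_self (h : IsQMatrix q X) (i : Fin m) : wedge q (X i) * wedge q (X i) = 0 := by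
  refine LinearMap.ext fun f => funext fun S => ?_
  simp only [Module.End.mul_apply, wedge_wedge_apply, LinearMap.zero_apply, Pi.zero_apply]
  refine Finset.sum_eq_zero fun j _ => Finset.sum_eq_zero fun l _ => ?_
  split_ifs with hjl
  · simp [h.row hjl]
  · rfl

theorem wedge_mul_of_lt (h : IsQMatrix q X) (hq : q ≠ 0) {i k : Fin m} (hik : i < k) :
    wedge q (X k) * wedge q (X i) = (-q) • (wedge q (X i) * wedge q (X k)) := by
  refine LinearMap.ext fun f => funext fun S => ?_
  simp only [Module.End.mul_apply, wedge_wedge_apply, LinearMap.smul_apply, Pi.smul_apply,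
    Finset.smul_sum]
  refine Finset.sum_congr rfl fun j _ => Finset.sum_congr rfl fun l _ => ?_
  split_ifs with hjl
  · have hminor : X k j * X i l - q • (X k l * X i j) =
        (-q) • (X i j * X k l - q • (X i l * X k j)) := by
      rw [h.diag hik hjl, h.anti hik hjl]
      match_scalars <;> field_simp
      ring
    rw [hminor, smul_mul_assoc, smul_comm]
  · simp

end Wedge

section Laplace

variable {t : ℕ} {X : Matrix (Fin (t + 1)) (Fin (t + 1)) A}

theorem sum_mul_qDet_submatrix (h : IsQMatrix q X) (hq : q ≠ 0) (i k : Fin (t + 1)) :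
    ∑ j : Fin (t + 1), (-q) ^ (j : ℕ) •
      (X i j * qDet q (X.submatrix k.succAbove j.succAbove)) =
      if i = k then (-q) ^ (k : ℕ) • qDet q X else 0 := by
  have hwedge : ∑ j : Fin (t + 1), (-q) ^ (j : ℕ) •
      (X i j * qDet q (X.submatrix k.succAbove j.succAbove)) =
      (wedge q (X i) * (List.ofFn fun a => wedge q (X (k.succAbove a))).prod)
        (Pi.single ∅ 1) Finset.univ := by
    have := prod_wedge_apply_univ q
      (Matrix.of (Fin.cons (X i) fun a => X (k.succAbove a)))
    rw [qDet_succ_row_zero, List.ofFn_succ, List.prod_cons] at this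
    exact this.symm
  rw [hwedge]
  split_ifs with hik
  · rw [hik, mul_prod_ofFn_succAbove (fun a => wedge q (X a)) k fun _ hi => h.wedge_mul_of_lt hq hi,
      LinearMap.smul_apply, Pi.smul_apply, prod_wedge_apply_univ]
  · obtain ⟨a, rfl⟩ := Fin.exists_succAbove_eq hik
    rw [mul_prod_ofFn_eq_zero (fun a => wedge q (X (k.succAbove a))) a (h.wedge_mul_self _)
      fun _ hb => h.wedge_mul_of_lt hq (Fin.strictMono_succAbove k hb)]
    rfl

theorem sum_qDet_submatrix_mul (h : IsQMatrix q X) (hq : q ≠ 0) (i k : Fin (t + 1)) :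
    ∑ j : Fin (t + 1), (-q) ^ (j.rev : ℕ) •
      (qDet q (X.submatrix k.succAbove j.succAbove) * X i j) =
      if i = k then (-q) ^ (k.rev : ℕ) • qDet q X else 0 := by
  have hrev := congrArg MulOpposite.unop (h.op_rev.sum_mul_qDet_submatrix hq i.rev k.rev)
  have hminor : ∀ j : Fin (t + 1),
      ((Matrix.of fun i j => MulOpposite.op (X i.rev j.rev)).submatrix k.rev.succAbove
        j.succAbove) = Matrix.of fun a b => MulOpposite.op
          ((X.submatrix k.succAbove j.rev.succAbove) a.rev b.rev) := by
    intro j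
    ext a b
    simp [Fin.rev_succAbove]
  simp only [hminor, qDet_op_rev, Matrix.of_apply, Fin.rev_rev, Fin.rev_inj, Finset.unop_sum,
    MulOpposite.unop_smul, MulOpposite.unop_mul, MulOpposite.unop_op, apply_ite MulOpposite.unop,
    MulOpposite.unop_zero] at hrev
  rw [← hrev, ← Equiv.sum_comp Fin.revPerm]
  simp only [Fin.revPerm_apply, Fin.rev_rev]

end Laplace

end IsQMatrix

/-- The quantum adjugate: the signed quantum minors of corank one, normalized so that its products
with a quantum matrix on both sides are the quantum determinant. -/
def qAdjugate {A : Type*} [Ring A] [Algebra ℂ A] (q : ℂ) {t : ℕ}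
    (X : Matrix (Fin (t + 1)) (Fin (t + 1)) A) : Matrix (Fin (t + 1)) (Fin (t + 1)) A :=
  Matrix.of fun j k =>
    ((-q) ^ (j : ℕ) * ((-q) ^ (k : ℕ))⁻¹) • qDet q (X.submatrix k.succAbove j.succAbove)

namespace IsQMatrix

variable {A : Type*} [Ring A] [Algebra ℂ A] {q : ℂ} {t : ℕ}
  {X : Matrix (Fin (t + 1)) (Fin (t + 1)) A}

theorem mul_qAdjugate (h : IsQMatrix q X) (hq : q ≠ 0) :
    X * qAdjugate q X = Matrix.diagonal fun _ => qDet q X := by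
  ext i k
  have hk : (-q) ^ (k : ℕ) ≠ 0 := pow_ne_zero _ (neg_ne_zero.2 hq)
  have hsum := congrArg (fun a => ((-q) ^ (k : ℕ))⁻¹ • a) (h.sum_mul_qDet_submatrix hq i k)
  simp only [Finset.smul_sum, smul_ite, smul_zero, smul_smul, inv_mul_cancel₀ hk, one_smul] at hsum
  rw [Matrix.mul_apply, Matrix.diagonal_apply, ← hsum]
  exact Finset.sum_congr rfl fun j _ => by
    rw [qAdjugate, Matrix.of_apply, mul_smul_comm, mul_comm ((-q) ^ (j : ℕ))]

theorem qAdjugate_mul (h : IsQMatrix q X) (hq : q ≠ 0) :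
    qAdjugate q X * X = Matrix.diagonal fun _ => qDet q X := by
  ext k i
  have hpow : ∀ j : ℕ, (-q) ^ j ≠ 0 := fun j => pow_ne_zero _ (neg_ne_zero.2 hq)
  have hsum := congrArg (fun a => ((-q) ^ (k.rev : ℕ))⁻¹ • a)
    (h.transpose.sum_qDet_submatrix_mul hq i k)
  simp only [Finset.smul_sum, smul_ite, smul_zero, smul_smul, inv_mul_cancel₀ (hpow _), one_smul,
    h.qDet_transpose] at hsum
  rw [Matrix.mul_apply, Matrix.diagonal_apply]
  simp only [eq_comm (a := k)]
  rw [← hsum]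
  refine Finset.sum_congr rfl fun j _ => ?_
  have hrev : ∀ j : Fin (t + 1), (-q) ^ (j.rev : ℕ) * (-q) ^ (j : ℕ) = (-q) ^ t := fun j => by
    rw [← pow_add, Fin.val_rev]; congr 1; omega
  have hscalar : (-q) ^ (k : ℕ) * ((-q) ^ (j : ℕ))⁻¹ =
      ((-q) ^ (k.rev : ℕ))⁻¹ * (-q) ^ (j.rev : ℕ) := by
    rw [← div_eq_mul_inv, inv_mul_eq_div, div_eq_div_iff (hpow _) (hpow _), mul_comm, hrev, hrev]
  rw [qAdjugate, Matrix.of_apply, hscalar, smul_mul_assoc, Matrix.transpose_apply,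
    ← Matrix.transpose_submatrix, (h.submatrix (Fin.strictMono_succAbove j)
      (Fin.strictMono_succAbove k)).qDet_transpose]

theorem commute_qDet {n : ℕ} {X : Matrix (Fin n) (Fin n) A} (h : IsQMatrix q X) (hq : q ≠ 0)
    (i l : Fin n) : Commute (qDet q X) (X i l) := by
  cases n with
  | zero => exact i.elim0
  | succ t =>
    have hassoc := congrFun (congrFun (mul_assoc X (qAdjugate q X) X) i) l
    rw [h.mul_qAdjugate hq, h.qAdjugate_mul hq] at hassoc
    simpa [commute_iff_eq] using hassoc

end IsQMatrix

theorem OqM.induction {n : ℕ} {q : ℂ} {P : OqM n q → Prop} (one : P 1)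
    (smul : ∀ (c : ℂ) a, P a → P (c • a)) (add : ∀ a b, P a → P b → P (a + b))
    (mul : ∀ i j a, P a → P (genX n q i j * a)) (a : OqM n q) : P a := by
  obtain ⟨a, rfl⟩ := mkM_surjective n q a
  suffices ∀ b, P b → P (mkM n q a * b) by simpa using this 1 one
  induction a using FreeAlgebra.induction with
  | grade0 r => intro b hb; simpa [Algebra.smul_def] using smul r b hb
  | grade1 x => intro b hb; exact mul x.1 x.2 b hb
  | mul a b ha hb => intro c hc; rw [map_mul, mul_assoc]; exact ha _ (hb _ hc)
  | add a b ha hb => intro c hc; rw [map_add, add_mul]; exact add _ _ (ha _ hc) (hb _ hc)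

theorem commute_detM {n : ℕ} {q : ℂ} (hq : q ≠ 0) (a : OqM n q) : Commute (detM n q) a := by
  induction a using OqM.induction with
  | one => exact Commute.one_right _
  | smul c a ha => exact ha.smul_right c
  | add a b ha hb => exact ha.add_right hb
  | mul i j a ha => exact ((isQMatrix_genX n q).commute_qDet hq i j).mul_right ha

/-! ### Ore extensions -/

open Polynomial

section Ore

variable {𝕜 R A : Type*} [CommRing 𝕜] [Ring R] [Algebra 𝕜 R] [Ring A] [Algebra 𝕜 A]

theorem submodule_eq_top_of_mul_mem {s : Set A} (hs : Algebra.adjoin 𝕜 s = ⊤)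
    {P : Submodule 𝕜 A} (h1 : 1 ∈ P) (hP : ∀ x ∈ s, ∀ a ∈ P, x * a ∈ P) : P = ⊤ := by
  have key : ∀ a ∈ Algebra.adjoin 𝕜 s, ∀ b ∈ P, a * b ∈ P := by
    intro a ha
    induction ha using Algebra.adjoin_induction with
    | mem x hx => exact hP x hx
    | algebraMap c => exact fun b hb => Algebra.smul_def c b ▸ P.smul_mem c hb
    | add a b _ _ iha ihb => exact fun c hc => add_mul a b c ▸ P.add_mem (iha c hc) (ihb c hc)
    | mul a b _ _ iha ihb => exact fun c hc => (mul_assoc a b c).symm ▸ iha _ (ihb c hc)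
  exact eq_top_iff.2 fun a _ => mul_one a ▸ key a (hs ▸ Algebra.mem_top) 1 h1

/-- `δ` is a `τ`-derivation. -/
def IsTwistedDerivation (τ : R →ₐ[𝕜] R) (δ : R →ₗ[𝕜] R) : Prop :=
  ∀ a b, δ (a * b) = τ a * δ b + δ a * b

section UpperTriangular

theorem upperTri_mul (a b d a' b' d' : R) :
    !![a, b; 0, d] * !![a', b'; 0, d'] = !![a * a', a * b' + b * d'; 0, d * d'] := by
  simp

theorem upperTri_add (a b d a' b' d' : R) :
    !![a, b; 0, d] + !![a', b'; 0, d'] = !![a + a', b + b'; 0, d + d'] := by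
  simp

theorem upperTri_smul (c : 𝕜) (a b d : R) :
    c • !![a, b; 0, d] = !![c • a, c • b; 0, c • d] := by
  simp

/-- Twisted derivations are the upper right entries of homomorphisms to upper triangular
matrices. -/
theorem exists_isTwistedDerivation {s : Set R} (hs : Algebra.adjoin 𝕜 s = ⊤) {τ : R →ₐ[𝕜] R}
    {Θ : R →ₐ[𝕜] Matrix (Fin 2) (Fin 2) R} (hΘ : ∀ a ∈ s, ∃ d, Θ a = !![τ a, d; 0, a]) :
    ∃ δ : R →ₗ[𝕜] R, IsTwistedDerivation τ δ ∧ ∀ a, Θ a = !![τ a, δ a; 0, a] := by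
  let δ : R →ₗ[𝕜] R := Matrix.entryLinearMap 𝕜 R 0 1 ∘ₗ Θ.toLinearMap
  have hex : ∀ a ∈ Algebra.adjoin 𝕜 s, ∃ d, Θ a = !![τ a, d; 0, a] := by
    intro a ha
    induction ha using Algebra.adjoin_induction with
    | mem a ha => exact hΘ a ha
    | algebraMap c =>
      refine ⟨0, ?_⟩
      rw [AlgHom.commutes, AlgHom.commutes, Matrix.algebraMap_eq_diagonal]
      ext i j
      fin_cases i <;> fin_cases j <;> simp
    | add a b _ _ iha ihb =>
      obtain ⟨⟨d, hd⟩, e, he⟩ := iha, ihb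
      exact ⟨d + e, by rw [map_add, map_add, hd, he, upperTri_add]⟩
    | mul a b _ _ iha ihb =>
      obtain ⟨⟨d, hd⟩, e, he⟩ := iha, ihb
      exact ⟨τ a * e + d * b, by rw [map_mul, map_mul, hd, he, upperTri_mul]⟩
  have hδ : ∀ a, Θ a = !![τ a, δ a; 0, a] := fun a => by
    obtain ⟨d, hd⟩ := hex a (hs ▸ Algebra.mem_top)
    have hda : δ a = d := congrFun (congrFun hd 0) 1
    rw [hda, hd]
  refine ⟨δ, fun a b => ?_, hδ⟩
  have hmul := map_mul Θ a b
  rw [hδ, hδ, hδ, upperTri_mul] at hmul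
  exact congrFun (congrFun hmul 0) 1

end UpperTriangular

variable (τ : R →ₐ[𝕜] R) (δ : R →ₗ[𝕜] R)

/-- Left multiplication by the variable of the Ore extension `R[x; τ, δ]`, on polynomials with
coefficients written on the left. -/
def oreMulX : Module.End 𝕜 R[X] :=
  Polynomial.lsum fun k =>
    (monomial (k + 1)).restrictScalars 𝕜 ∘ₗ τ.toLinearMap + (monomial k).restrictScalars 𝕜 ∘ₗ δ

theorem oreMulX_monomial (k : ℕ) (r : R) :
    oreMulX τ δ (monomial k r) = monomial (k + 1) (τ r) + monomial k (δ r) := by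
  simp [oreMulX, Polynomial.lsum_apply, Polynomial.sum_monomial_index]

theorem coeff_oreMulX_succ (f : R[X]) (k : ℕ) :
    (oreMulX τ δ f).coeff (k + 1) = τ (f.coeff k) + δ (f.coeff (k + 1)) := by
  induction f using Polynomial.induction_on' with
  | add f g hf hg =>
    simp only [map_add, coeff_add, hf, hg]
    abel
  | monomial m r =>
    simp only [oreMulX_monomial, coeff_add, coeff_monomial, add_left_inj]
    split_ifs <;> simp

theorem natDegree_oreMulX_le (f : R[X]) : (oreMulX τ δ f).natDegree ≤ f.natDegree + 1 := by
  rw [natDegree_le_iff_coeff_eq_zero]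
  intro m hm
  obtain ⟨k, rfl⟩ : ∃ k, m = k + 1 := ⟨m - 1, by lia⟩
  rw [coeff_oreMulX_succ, coeff_eq_zero_of_natDegree_lt (by lia),
    coeff_eq_zero_of_natDegree_lt (by lia), map_zero, map_zero, add_zero]

theorem natDegree_oreMulX_pow_le (f : R[X]) (k : ℕ) :
    ((oreMulX τ δ ^ k) f).natDegree ≤ f.natDegree + k := by
  induction k with
  | zero => simp
  | succ k ih =>
    rw [pow_succ', Module.End.mul_apply]
    exact (natDegree_oreMulX_le τ δ _).trans (Nat.succ_le_succ ih)

theorem coeff_oreMulX_pow (f : R[X]) (k : ℕ) :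
    ((oreMulX τ δ ^ k) f).coeff (f.natDegree + k) = (τ ^ k) f.leadingCoeff := by
  induction k with
  | zero => simp
  | succ k ih =>
    rw [pow_succ', Module.End.mul_apply, ← add_assoc, coeff_oreMulX_succ, ih,
      coeff_eq_zero_of_natDegree_lt (Nat.lt_succ_of_le (natDegree_oreMulX_pow_le τ δ f k)),
      map_zero, add_zero, pow_succ', AlgHom.mul_apply]

/-- The product in the Ore extension `R[x; τ, δ]`. -/
def oreMul (f g : R[X]) : R[X] :=
  f.sum fun k r => C r * (oreMulX τ δ ^ k) g

theorem natDegree_oreMul_le (f g : R[X]) :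
    (oreMul τ δ f g).natDegree ≤ f.natDegree + g.natDegree := by
  refine natDegree_sum_le_of_forall_le _ _ fun k hk => (natDegree_C_mul_le _ _).trans ?_
  have hpow := natDegree_oreMulX_pow_le τ δ g k
  have hk' := le_natDegree_of_mem_supp k hk
  lia

theorem coeff_oreMul (f g : R[X]) :
    (oreMul τ δ f g).coeff (f.natDegree + g.natDegree) =
      f.leadingCoeff * (τ ^ f.natDegree) g.leadingCoeff := by
  rw [oreMul, Polynomial.sum_def, finsetSum_coeff, Finset.sum_eq_single f.natDegree]
  · rw [coeff_C_mul, add_comm f.natDegree, coeff_oreMulX_pow, coeff_natDegree]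
  · intro k hk hne
    have hpow := natDegree_oreMulX_pow_le τ δ g k
    have hk' := le_natDegree_of_mem_supp k hk
    rw [coeff_C_mul, coeff_eq_zero_of_natDegree_lt (p := (oreMulX τ δ ^ k) g) (by lia), mul_zero]
  · intro h
    rw [notMem_support_iff.1 h, C_0, zero_mul, coeff_zero]

variable {τ δ}

namespace IsTwistedDerivation

theorem map_one (hδ : IsTwistedDerivation τ δ) : δ 1 = 0 := by
  simpa using hδ 1 1

theorem map_algebraMap (hδ : IsTwistedDerivation τ δ) (c : 𝕜) : δ (algebraMap 𝕜 R c) = 0 := by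
  rw [Algebra.algebraMap_eq_smul_one, map_smul, hδ.map_one, smul_zero]

theorem oreMulX_C_mul (hδ : IsTwistedDerivation τ δ) (r : R) (f : R[X]) :
    oreMulX τ δ (C r * f) = C (τ r) * oreMulX τ δ f + C (δ r) * f := by
  induction f using Polynomial.induction_on' with
  | add f g hf hg =>
    simp only [mul_add, map_add, hf, hg]
    abel
  | monomial k s =>
    simp only [C_mul_monomial, oreMulX_monomial, mul_add, map_mul, hδ r s, map_add]
    abel

theorem oreMulX_pow_one (hδ : IsTwistedDerivation τ δ) (k : ℕ) :
    (oreMulX τ δ ^ k) 1 = monomial k 1 := by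
  induction k with
  | zero => simp
  | succ k ih =>
    rw [pow_succ', Module.End.mul_apply, ih, oreMulX_monomial, _root_.map_one, hδ.map_one,
      map_zero, add_zero]

end IsTwistedDerivation

/-- Evaluation at `x` of the polynomials with coefficients written on the left; unlike
`Polynomial.eval₂`, it is bundled as a linear map, and it is not multiplicative. -/
def oreEval (ι : R →ₐ[𝕜] A) (x : A) : R[X] →ₗ[𝕜] A :=
  Polynomial.lsum fun k => LinearMap.mulRight 𝕜 (x ^ k) ∘ₗ ι.toLinearMap

/-- `A` is the Ore extension `R[x; τ, δ]`. -/
structure IsOreExtension (ι : R →ₐ[𝕜] A) (x : A) (τ : R →ₐ[𝕜] R) (δ : R →ₗ[𝕜] R) : Prop where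
  comm : ∀ r, x * ι r = ι (τ r) * x + ι (δ r)
  bijective : Function.Bijective (oreEval ι x)

section OreEval

variable {ι : R →ₐ[𝕜] A} {x : A}

theorem oreEval_monomial (k : ℕ) (r : R) : oreEval ι x (monomial k r) = ι r * x ^ k := by
  simp [oreEval, Polynomial.lsum_apply, Polynomial.sum_monomial_index]

theorem oreEval_C (r : R) : oreEval ι x (C r) = ι r := by
  rw [← monomial_zero_left, oreEval_monomial, pow_zero, mul_one]

theorem oreEval_mul_X (f : R[X]) : oreEval ι x (f * X) = oreEval ι x f * x := by
  induction f using Polynomial.induction_on' with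
  | add f g hf hg => simp only [add_mul, map_add, hf, hg]
  | monomial k r => rw [monomial_mul_X, oreEval_monomial, oreEval_monomial, pow_succ, mul_assoc]

theorem oreEval_C_mul (r : R) (f : R[X]) : oreEval ι x (C r * f) = ι r * oreEval ι x f := by
  induction f using Polynomial.induction_on' with
  | add f g hf hg => simp only [mul_add, map_add, hf, hg]
  | monomial k s => rw [C_mul_monomial, oreEval_monomial, oreEval_monomial, map_mul, mul_assoc]

theorem oreEval_oreMulX (hc : ∀ r, x * ι r = ι (τ r) * x + ι (δ r)) (f : R[X]) :
    oreEval ι x (oreMulX τ δ f) = x * oreEval ι x f := by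
  induction f using Polynomial.induction_on' with
  | add f g hf hg => simp only [map_add, mul_add, hf, hg]
  | monomial k r =>
    rw [oreMulX_monomial, map_add, oreEval_monomial, oreEval_monomial, oreEval_monomial,
      ← mul_assoc, hc, add_mul, mul_assoc, ← pow_succ']

theorem oreEval_oreMul (hc : ∀ r, x * ι r = ι (τ r) * x + ι (δ r)) (f g : R[X]) :
    oreEval ι x (oreMul τ δ f g) = oreEval ι x f * oreEval ι x g := by
  have hpow : ∀ k, oreEval ι x ((oreMulX τ δ ^ k) g) = x ^ k * oreEval ι x g := by
    intro k
    induction k with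
    | zero => simp
    | succ k ih =>
      rw [pow_succ', Module.End.mul_apply, oreEval_oreMulX hc, ih, pow_succ', mul_assoc]
  conv_rhs => rw [f.as_sum_support]
  simp only [oreMul, Polynomial.sum_def, map_sum, Finset.sum_mul, oreEval_C_mul, hpow,
    oreEval_monomial, mul_assoc]

theorem oreEval_injective (hδ : IsTwistedDerivation τ δ) {ρ : A →ₐ[𝕜] Module.End 𝕜 R[X]}
    (hρx : ρ x = oreMulX τ δ) (hρ : ∀ r f, ρ (ι r) f = C r * f) :
    Function.Injective (oreEval ι x) := by
  refine Function.LeftInverse.injective (g := fun a => ρ a 1) fun f => ?_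
  change ρ (oreEval ι x f) 1 = f
  induction f using Polynomial.induction_on' with
  | add f g hf hg => rw [map_add, map_add, LinearMap.add_apply, hf, hg]
  | monomial k r =>
    rw [oreEval_monomial, map_mul, map_pow, hρx, Module.End.mul_apply, hδ.oreMulX_pow_one, hρ,
      C_mul_monomial, mul_one]

theorem oreEval_surjective (hc : ∀ r, x * ι r = ι (τ r) * x + ι (δ r))
    (hA : Algebra.adjoin 𝕜 (insert x (Set.range ι)) = ⊤) : Function.Surjective (oreEval ι x) := by
  rw [← LinearMap.range_eq_top]
  refine submodule_eq_top_of_mul_mem hA ⟨1, by rw [← C_1, oreEval_C, map_one]⟩ ?_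
  rintro _ (rfl | ⟨r, rfl⟩) _ ⟨f, rfl⟩
  · exact ⟨_, oreEval_oreMulX hc f⟩
  · exact ⟨_, oreEval_C_mul r f⟩

theorem comm_of_adjoin_eq_top (hδ : IsTwistedDerivation τ δ) {s : Set R}
    (hs : Algebra.adjoin 𝕜 s = ⊤) (h : ∀ r ∈ s, x * ι r = ι (τ r) * x + ι (δ r)) (r : R) :
    x * ι r = ι (τ r) * x + ι (δ r) := by
  have hr : r ∈ Algebra.adjoin 𝕜 s := hs ▸ Algebra.mem_top
  induction hr using Algebra.adjoin_induction with
  | mem r hr => exact h r hr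
  | algebraMap c =>
    rw [hδ.map_algebraMap, map_zero, add_zero, τ.commutes, ι.commutes]
    exact (Algebra.commutes c x).symm
  | add a b _ _ ha hb =>
    simp only [map_add, mul_add, add_mul, ha, hb]
    abel
  | mul a b _ _ ha hb =>
    rw [map_mul, ← mul_assoc, ha, add_mul, mul_assoc, hb, hδ a b]
    simp only [map_mul, map_add, mul_add, mul_assoc, add_assoc]

end OreEval

namespace IsOreExtension

variable {ι : R →ₐ[𝕜] A} {x : A}

theorem noZeroDivisors (h : IsOreExtension ι x τ δ) (hτ : Function.Injective τ)
    [NoZeroDivisors R] : NoZeroDivisors A := by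
  refine ⟨fun {a b} hab => ?_⟩
  obtain ⟨⟨f, rfl⟩, g, rfl⟩ := h.bijective.2 a, h.bijective.2 b
  have hfg : oreMul τ δ f g = 0 :=
    h.bijective.1 (by rw [oreEval_oreMul h.comm, hab, map_zero])
  have hlead := coeff_oreMul τ δ f g
  have hpow : Function.Injective (τ ^ f.natDegree) := by
    rw [AlgHom.coe_pow]
    exact hτ.iterate _
  rw [hfg, coeff_zero, eq_comm, mul_eq_zero, map_eq_zero_iff _ hpow, leadingCoeff_eq_zero,
    leadingCoeff_eq_zero] at hlead
  rcases hlead with rfl | rfl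
  · exact Or.inl (map_zero _)
  · exact Or.inr (map_zero _)

theorem map_leadingCoeff_of_commute (h : IsOreExtension ι x τ δ) {f : R[X]} {s : R}
    (hf : Commute (oreEval ι x f) (x + ι s)) : τ f.leadingCoeff = f.leadingCoeff := by
  have heq : f * X + oreMul τ δ f (C s) = oreMulX τ δ f + C s * f := h.bijective.1 <| by
    rw [map_add, map_add, oreEval_mul_X, oreEval_oreMul h.comm, oreEval_C, oreEval_oreMulX h.comm,
      oreEval_C_mul, ← mul_add, hf.eq, add_mul]
  have hdeg : (oreMul τ δ f (C s)).natDegree ≤ f.natDegree := by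
    simpa using natDegree_oreMul_le τ δ f (C s)
  have hcoeff := congrArg (coeff · (f.natDegree + 1)) heq
  simp only [coeff_add, coeff_mul_X, coeff_oreMulX_succ, coeff_C_mul, coeff_natDegree,
    coeff_eq_zero_of_natDegree_lt (Nat.lt_succ_of_le hdeg),
    coeff_eq_zero_of_natDegree_lt (Nat.lt_succ_self f.natDegree), map_zero, mul_zero,
    add_zero] at hcoeff
  exact hcoeff.symm

end IsOreExtension

end Ore

/-! ### The Ore extension by one entry of a quantum matrix -/

/-- The relations between the generators of the subalgebra of quantum matrices that is generated by
the entries in the positions `U`, a final segment for the lexicographic order; the other entries of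
`X` are `0` by convention. -/
structure IsQMatrixOn (q : ℂ) {A : Type*} [Ring A] [Algebra ℂ A] {n : ℕ} (U : Set (Fin n × Fin n))
    (X : Matrix (Fin n) (Fin n) A) : Prop where
  diag : ∀ ⦃i j k l⦄, (i, j) ∈ U → i < k → j < l →
    X i j * X k l = X k l * X i j + (q - q⁻¹) • (X i l * X k j)
  row : ∀ ⦃i j l⦄, j < l → X i j * X i l = q • (X i l * X i j)
  col : ∀ ⦃i j k⦄, i < k → X i j * X k j = q • (X k j * X i j)
  anti : ∀ ⦃i j k l⦄, i < k → l < j → X i j * X k l = X k l * X i j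
  zero : ∀ ⦃i j⦄, (i, j) ∉ U → X i j = 0

theorem IsQMatrix.isQMatrixOn {q : ℂ} {A : Type*} [Ring A] [Algebra ℂ A] {n : ℕ}
    {X : Matrix (Fin n) (Fin n) A} (h : IsQMatrix q X) {U : Set (Fin n × Fin n)}
    (h0 : ∀ ⦃i j⦄, (i, j) ∉ U → X i j = 0) : IsQMatrixOn q U X :=
  ⟨fun _ _ _ _ _ hik hjl => h.diag hik hjl, h.row, h.col, h.anti, h0⟩

theorem isQMatrixOn_univ {q : ℂ} {A : Type*} [Ring A] [Algebra ℂ A] {n : ℕ}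
    {X : Matrix (Fin n) (Fin n) A} : IsQMatrixOn q Set.univ X ↔ IsQMatrix q X :=
  ⟨fun h => ⟨fun _ _ _ _ hik hjl => h.diag trivial hik hjl, h.row, h.col, h.anti⟩,
    fun h => h.isQMatrixOn fun _ _ hU => (hU trivial).elim⟩

/-- The positions after `p` in the lexicographic order. -/
def lexGT {n : ℕ} (p : Fin n × Fin n) : Set (Fin n × Fin n) :=
  {r | p.1 < r.1 ∨ (p.1 = r.1 ∧ p.2 < r.2)}

theorem mem_lexGT_of_lt {n : ℕ} {p : Fin n × Fin n} {a b : Fin n} (h : p.1 < a) :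
    (a, b) ∈ lexGT p :=
  Or.inl h

theorem mem_lexGT_of_eq {n : ℕ} {p : Fin n × Fin n} {b : Fin n} (h : p.2 < b) :
    (p.1, b) ∈ lexGT p :=
  Or.inr ⟨rfl, h⟩

section OreData

variable {q : ℂ} {A : Type*} [Ring A] [Algebra ℂ A] {n : ℕ}

/-- The values on generators of the derivation in the Ore extension by the entry at `p`. -/
def oreDelta (q : ℂ) (X : Matrix (Fin n) (Fin n) A) (p : Fin n × Fin n) :
    Matrix (Fin n) (Fin n) A :=
  fun k l => if p.1 < k ∧ p.2 < l then (q - q⁻¹) • (X p.1 l * X k p.2) else 0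

/-- The automorphism in the Ore extension by the entry at `p` multiplies the generator at `(k, l)`
by this scalar. -/
def oreScalar (q : ℂ) (p : Fin n × Fin n) (k l : Fin n) : ℂ := if k = p.1 ∨ l = p.2 then q else 1

variable {X : Matrix (Fin n) (Fin n) A} {p : Fin n × Fin n} {k l : Fin n}

theorem oreDelta_of_lt (hk : p.1 < k) (hl : p.2 < l) :
    oreDelta q X p k l = (q - q⁻¹) • (X p.1 l * X k p.2) := if_pos ⟨hk, hl⟩

theorem oreDelta_left : oreDelta q X p p.1 l = 0 := if_neg fun h => lt_irrefl _ h.1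

theorem oreDelta_right : oreDelta q X p k p.2 = 0 := if_neg fun h => lt_irrefl _ h.2

theorem oreDelta_of_gt (hl : l < p.2) : oreDelta q X p k l = 0 := if_neg fun h => hl.not_gt h.2

theorem oreDelta_of_notMem (h : (k, l) ∉ lexGT p) : oreDelta q X p k l = 0 :=
  if_neg fun hkl => h (mem_lexGT_of_lt hkl.1)

theorem oreScalar_left : oreScalar q p p.1 l = q := if_pos (Or.inl rfl)

theorem oreScalar_right : oreScalar q p k p.2 = q := if_pos (Or.inr rfl)

theorem oreScalar_of_lt (hk : p.1 < k) (hl : p.2 < l) : oreScalar q p k l = 1 :=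
  if_neg fun h => h.elim hk.ne' hl.ne'

theorem oreScalar_of_gt (hk : p.1 < k) (hl : l < p.2) : oreScalar q p k l = 1 :=
  if_neg fun h => h.elim hk.ne' hl.ne

theorem oreScalar_ne_zero (hq : q ≠ 0) : oreScalar q p k l ≠ 0 := by
  rw [oreScalar]
  split_ifs
  exacts [hq, one_ne_zero]

theorem oreScalar_mul_oreScalar {a b c d : Fin n} (hac : a < c) (hbd : b < d)
    (hab : (a, b) ∈ lexGT p) :
    oreScalar q p a d * oreScalar q p c b = oreScalar q p a b * oreScalar q p c d := by
  simp only [oreScalar]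
  obtain ha | ⟨rfl, hb⟩ : p.1 < a ∨ p.1 = a ∧ p.2 < b := hab
  · simp [ha.ne', (ha.trans hac).ne', mul_comm]
  · simp [hac.ne', hb.ne', (hb.trans hbd).ne']

end OreData

namespace IsQMatrixOn

variable {q : ℂ} {A : Type*} [Ring A] [Algebra ℂ A] {n : ℕ} {X : Matrix (Fin n) (Fin n) A}

section Reorder

variable {U : Set (Fin n × Fin n)} {i j k l : Fin n}

theorem row_rev (h : IsQMatrixOn q U X) (hq : q ≠ 0) (hjl : j < l) :
    X i l * X i j = q⁻¹ • (X i j * X i l) := by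
  rw [h.row hjl, smul_smul, inv_mul_cancel₀ hq, one_smul]

theorem col_rev (h : IsQMatrixOn q U X) (hq : q ≠ 0) (hik : i < k) :
    X k j * X i j = q⁻¹ • (X i j * X k j) := by
  rw [h.col hik, smul_smul, inv_mul_cancel₀ hq, one_smul]

/-- The scalar `1` keeps `simp` from treating this as a permutation lemma. -/
theorem anti_rev (h : IsQMatrixOn q U X) (hik : i < k) (hlj : l < j) :
    X k l * X i j = (1 : ℂ) • (X i j * X k l) := by rw [one_smul, h.anti hik hlj]

theorem diag_rev (h : IsQMatrixOn q U X) (hU : (i, j) ∈ U) (hik : i < k) (hjl : j < l) :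
    X k l * X i j = X i j * X k l - (q - q⁻¹) • (X i l * X k j) := by
  rw [h.diag hU hik hjl, add_sub_cancel_right]

theorem row_rev_assoc (h : IsQMatrixOn q U X) (hq : q ≠ 0) (hjl : j < l) (r : A) :
    X i l * (X i j * r) = q⁻¹ • (X i j * (X i l * r)) := by
  rw [← mul_assoc, h.row_rev hq hjl, smul_mul_assoc, mul_assoc]

theorem col_rev_assoc (h : IsQMatrixOn q U X) (hq : q ≠ 0) (hik : i < k) (r : A) :
    X k j * (X i j * r) = q⁻¹ • (X i j * (X k j * r)) := by
  rw [← mul_assoc, h.col_rev hq hik, smul_mul_assoc, mul_assoc]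

theorem anti_rev_assoc (h : IsQMatrixOn q U X) (hik : i < k) (hlj : l < j) (r : A) :
    X k l * (X i j * r) = (1 : ℂ) • (X i j * (X k l * r)) := by
  rw [← mul_assoc, h.anti_rev hik hlj, smul_mul_assoc, mul_assoc]

end Reorder

section ReorderLex

variable {p : Fin n × Fin n} {i j k l : Fin n}

theorem diag_rev_lt (h : IsQMatrixOn q (lexGT p) X) (hi : p.1 < i) (hik : i < k) (hjl : j < l) :
    X k l * X i j = X i j * X k l - (q - q⁻¹) • (X i l * X k j) :=
  h.diag_rev (mem_lexGT_of_lt hi) hik hjl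

theorem diag_rev_eq (h : IsQMatrixOn q (lexGT p) X) (hj : p.2 < j) (hik : p.1 < k) (hjl : j < l) :
    X k l * X p.1 j = X p.1 j * X k l - (q - q⁻¹) • (X p.1 l * X k j) :=
  h.diag_rev (mem_lexGT_of_eq hj) hik hjl

theorem diag_rev_eq_assoc (h : IsQMatrixOn q (lexGT p) X) (hj : p.2 < j) (hik : p.1 < k)
    (hjl : j < l) (r : A) :
    X k l * (X p.1 j * r) = X p.1 j * (X k l * r) - (q - q⁻¹) • (X p.1 l * (X k j * r)) := by
  rw [← mul_assoc, h.diag_rev_eq hj hik hjl, sub_mul, smul_mul_assoc, mul_assoc, mul_assoc]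

end ReorderLex

section OreDelta

variable {p : Fin n × Fin n} {a b c d : Fin n}

theorem lt_lt_cases (i : Fin n) (h : b < d) :
    (i < b ∧ i < d) ∨ i = b ∨ (b < i ∧ i < d) ∨ i = d ∨ (b < i ∧ d < i) := by
  grind

/-! The next four identities say that the values `oreDelta` on the generators are compatible with
the defining relations. In each of them, both sides are brought to normal form with respect to the
lexicographic order of the positions. -/

theorem oreDelta_row (h : IsQMatrixOn q (lexGT p) X) (hq : q ≠ 0) (hbd : b < d)
    (hab : (a, b) ∈ lexGT p) :
    oreScalar q p a b • X a b * oreDelta q X p a d + oreDelta q X p a b * X a d =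
      q • (oreScalar q p a d • X a d * oreDelta q X p a b + oreDelta q X p a d * X a b) := by
  obtain ha | ⟨rfl, -⟩ : p.1 < a ∨ p.1 = a ∧ p.2 < b := hab
  · obtain ⟨hb, hd⟩ | rfl | ⟨hb, hd⟩ | rfl | ⟨hb, hd⟩ := lt_lt_cases p.2 hbd
    all_goals
      simp (disch := assumption) only [oreDelta_of_lt, oreDelta_right, oreDelta_of_gt,
        oreScalar_right, oreScalar_of_lt, oreScalar_of_gt, mul_zero, zero_mul, add_zero, zero_add,
        smul_zero, one_smul, smul_mul_assoc, mul_smul_comm, mul_assoc, smul_add, smul_sub,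
        h.row_rev hq, h.anti_rev_assoc, h.diag_rev_eq_assoc]
      try match_scalars <;> field_simp <;> ring
  · simp only [oreDelta_left, mul_zero, zero_mul, add_zero, smul_zero]

theorem oreDelta_col (h : IsQMatrixOn q (lexGT p) X) (hq : q ≠ 0) (hac : a < c)
    (hab : (a, b) ∈ lexGT p) :
    oreScalar q p a b • X a b * oreDelta q X p c b + oreDelta q X p a b * X c b =
      q • (oreScalar q p c b • X c b * oreDelta q X p a b + oreDelta q X p c b * X a b) := by
  obtain ha | ⟨rfl, hb⟩ : p.1 < a ∨ p.1 = a ∧ p.2 < b := hab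
  on_goal 1 =>
    have hc := ha.trans hac
    rcases lt_trichotomy p.2 b with hb | rfl | hb
  all_goals
    simp (disch := assumption) only [oreDelta_of_lt, oreDelta_left, oreDelta_right,
      oreDelta_of_gt, oreScalar_left, oreScalar_right, oreScalar_of_lt, oreScalar_of_gt, mul_zero,
      zero_mul, add_zero, zero_add, smul_zero, one_smul, smul_mul_assoc, mul_smul_comm, mul_assoc,
      mul_sub, smul_add, smul_sub, h.col_rev_assoc hq, h.anti_rev, h.diag_rev_lt]
    try match_scalars <;> field_simp <;> ring

theorem oreDelta_anti (h : IsQMatrixOn q (lexGT p) X) (hq : q ≠ 0) (hac : a < c) (hdb : d < b)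
    (hab : (a, b) ∈ lexGT p) :
    oreScalar q p a b • X a b * oreDelta q X p c d + oreDelta q X p a b * X c d =
      oreScalar q p c d • X c d * oreDelta q X p a b + oreDelta q X p c d * X a b := by
  obtain ha | ⟨rfl, hb⟩ : p.1 < a ∨ p.1 = a ∧ p.2 < b := hab
  on_goal 2 => rcases lt_trichotomy p.2 d with hd | rfl | hd
  on_goal 1 =>
    have hc := ha.trans hac
    obtain ⟨hd, hb⟩ | rfl | ⟨hd, hb⟩ | rfl | ⟨hd, hb⟩ := lt_lt_cases p.2 hdb
  all_goals
    simp (disch := assumption) only [oreDelta_of_lt, oreDelta_left, oreDelta_right,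
      oreDelta_of_gt, oreScalar_left, oreScalar_right, oreScalar_of_lt, oreScalar_of_gt, mul_zero,
      zero_mul, add_zero, zero_add, one_smul, smul_mul_assoc, mul_smul_comm, mul_assoc,
      mul_sub, smul_sub, h.row_rev_assoc hq, h.col_rev hq, h.anti_rev, h.anti_rev_assoc,
      h.diag_rev_lt, h.diag_rev_eq_assoc]
    try match_scalars <;> field_simp

theorem oreDelta_diag (h : IsQMatrixOn q (lexGT p) X) (hq : q ≠ 0) (hac : a < c) (hbd : b < d)
    (hab : (a, b) ∈ lexGT p) :
    oreScalar q p a b • X a b * oreDelta q X p c d + oreDelta q X p a b * X c d =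
      oreScalar q p c d • X c d * oreDelta q X p a b + oreDelta q X p c d * X a b +
      (q - q⁻¹) • (oreScalar q p a d • X a d * oreDelta q X p c b +
        oreDelta q X p a d * X c b) := by
  obtain ha | ⟨rfl, hb⟩ : p.1 < a ∨ p.1 = a ∧ p.2 < b := hab
  on_goal 2 => have hd := hb.trans hbd
  on_goal 1 =>
    have hc := ha.trans hac
    obtain ⟨hb, hd⟩ | rfl | ⟨hb, hd⟩ | rfl | ⟨hb, hd⟩ := lt_lt_cases p.2 hbd
  all_goals
    simp (disch := assumption) only [oreDelta_of_lt, oreDelta_left, oreDelta_right,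
      oreDelta_of_gt, oreScalar_left, oreScalar_right, oreScalar_of_lt, oreScalar_of_gt, mul_zero,
      zero_mul, add_zero, zero_add, smul_zero, one_smul, smul_mul_assoc, mul_smul_comm, mul_assoc,
      mul_sub, smul_add, smul_sub, h.row_rev_assoc hq, h.col_rev hq, h.anti_rev,
      h.anti_rev_assoc, h.diag_rev_lt, h.diag_rev_eq_assoc]
    try match_scalars <;> field_simp <;> ring

end OreDelta

theorem smul {U : Set (Fin n × Fin n)} (h : IsQMatrixOn q U X) (c : Fin n → Fin n → ℂ)
    (hc : ∀ ⦃i j k l⦄, (i, j) ∈ U → i < k → j < l → c i l * c k j = c i j * c k l) :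
    IsQMatrixOn q U (fun i j => c i j • X i j : Matrix (Fin n) (Fin n) A) where
  diag i j k l hU hik hjl := by
    simp only [smul_mul_smul_comm, h.diag hU hik hjl, hc hU hik hjl]
    module
  row i j l hjl := by
    simp only [smul_mul_smul_comm, h.row hjl]
    module
  col i j k hik := by
    simp only [smul_mul_smul_comm, h.col hik]
    module
  anti i j k l hik hlj := by
    simp only [smul_mul_smul_comm, h.anti hik hlj, mul_comm]
  zero i j hU := by rw [h.zero hU, smul_zero]

end IsQMatrixOn

/-- The matrix of upper triangular matrices that encode the automorphism and the derivation of the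
Ore extension by the entry at `p`: a homomorphism `a ↦ !![τ a, δ a; 0, a]` amounts to a
homomorphism `τ` and a `τ`-derivation `δ`. -/
def oreMatrix {A : Type*} [Ring A] [Algebra ℂ A] {n : ℕ} (q : ℂ) (X : Matrix (Fin n) (Fin n) A)
    (p : Fin n × Fin n) : Matrix (Fin n) (Fin n) (Matrix (Fin 2) (Fin 2) A) :=
  fun k l => !![oreScalar q p k l • X k l, oreDelta q X p k l; 0, X k l]

theorem isQMatrixOn_oreMatrix {A : Type*} [Ring A] [Algebra ℂ A] {n : ℕ} {q : ℂ}
    {X : Matrix (Fin n) (Fin n) A} {p : Fin n × Fin n} (h : IsQMatrixOn q (lexGT p) X)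
    (hq : q ≠ 0) : IsQMatrixOn q (lexGT p) (oreMatrix q X p) := by
  have hs := h.smul (oreScalar q p) fun i j k l hU hik hjl => oreScalar_mul_oreScalar hik hjl hU
  have hz : ∀ ⦃k l⦄, (k, l) ∉ lexGT p → oreMatrix q X p k l = 0 := by
    intro k l hkl
    ext a b
    fin_cases a <;> fin_cases b <;>
      simp [oreMatrix, h.zero hkl, oreDelta_of_notMem hkl]
  refine ⟨fun i j k l hU hik hjl => ?_, fun i j l hjl => ?_, fun i j k hik => ?_,
    fun i j k l hik hlj => ?_, hz⟩
  · simp only [oreMatrix, upperTri_mul, upperTri_add, upperTri_smul]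
    rw [hs.diag hU hik hjl, h.diag hU hik hjl, h.oreDelta_diag hq hik hjl hU]
  · by_cases hU : (i, j) ∈ lexGT p
    · simp only [oreMatrix, upperTri_mul, upperTri_smul]
      rw [hs.row hjl, h.row hjl, h.oreDelta_row hq hjl hU]
    · simp [hz hU]
  · by_cases hU : (i, j) ∈ lexGT p
    · simp only [oreMatrix, upperTri_mul, upperTri_smul]
      rw [hs.col hik, h.col hik, h.oreDelta_col hq hik hU]
    · simp [hz hU]
  · by_cases hU : (i, j) ∈ lexGT p
    · simp only [oreMatrix, upperTri_mul]
      rw [hs.anti hik hlj, h.anti hik hlj, h.oreDelta_anti hq hik hlj hU]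
    · simp [hz hU]

/-- The positions from `p` on in the lexicographic order. -/
def lexGE {n : ℕ} (p : Fin n × Fin n) : Set (Fin n × Fin n) :=
  {r | p.1 < r.1 ∨ (p.1 = r.1 ∧ p.2 ≤ r.2)}

section Lex

variable {n : ℕ} {p : Fin n × Fin n} {i j k l : Fin n}

theorem mem_lexGT_or_eq_or_notMem_lexGE (p : Fin n × Fin n) (k l : Fin n) :
    (k, l) ∈ lexGT p ∨ (k = p.1 ∧ l = p.2) ∨ (k, l) ∉ lexGE p := by
  simp only [lexGT, lexGE, Set.mem_ofPred_eq]
  grind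

theorem lexGT_subset_lexGE (p : Fin n × Fin n) : lexGT p ⊆ lexGE p :=
  fun _ h => h.imp id fun h => ⟨h.1, h.2.le⟩

theorem notMem_lexGT_self (p : Fin n × Fin n) : p ∉ lexGT p := by
  simp [lexGT]

theorem mem_lexGE_self (p : Fin n × Fin n) : p ∈ lexGE p := Or.inr ⟨rfl, le_rfl⟩

theorem mem_lexGT_of_mem_lexGE (h : (i, j) ∈ lexGE p) (hik : i < k) : (k, l) ∈ lexGT p :=
  Or.inl (h.elim (fun h => h.trans hik) fun h => h.1.le.trans_lt hik)

theorem mem_lexGT_of_mem_lexGE_row (h : (i, j) ∈ lexGE p) (hjl : j < l) : (i, l) ∈ lexGT p :=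
  h.imp id fun h => ⟨h.1, h.2.trans_lt hjl⟩

theorem univ_eq_lexGE (n : ℕ) : (Set.univ : Set (Fin (n + 1) × Fin (n + 1))) = lexGE (0, 0) := by
  ext r
  simpa [lexGE] using (Fin.zero_le r.1).lt_or_eq

theorem mem_lexGT_iff {r : Fin n × Fin n} : r ∈ lexGT p ↔ toLex p < toLex r := by
  rw [Prod.Lex.lt_iff]
  rfl

theorem mem_lexGE_iff {r : Fin n × Fin n} : r ∈ lexGE p ↔ toLex p ≤ toLex r := by
  rw [Prod.Lex.le_iff]
  rfl

theorem lexGT_eq_empty_or_eq_lexGE (p : Fin n × Fin n) :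
    lexGT p = ∅ ∨ ∃ s ∈ lexGT p, lexGT p = lexGE s := by
  refine (lexGT p).eq_empty_or_nonempty.imp_right fun h => ?_
  obtain ⟨s, hs, hmin⟩ := Set.exists_min_image _ toLex (Set.toFinite _) h
  refine ⟨s, hs, Set.ext fun r => ⟨fun hr => mem_lexGE_iff.2 (hmin r hr), fun hr => ?_⟩⟩
  exact mem_lexGT_iff.2 ((mem_lexGT_iff.1 hs).trans_le (mem_lexGE_iff.1 hr))

end Lex

theorem map_oreDelta {q : ℂ} {n : ℕ} {p : Fin n × Fin n} {R A : Type*} [Ring R] [Algebra ℂ R]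
    [Ring A] [Algebra ℂ A] {Y : Matrix (Fin n) (Fin n) R} {X : Matrix (Fin n) (Fin n) A}
    {ι : R →ₐ[ℂ] A} (hι : ∀ ⦃k l⦄, (k, l) ∈ lexGT p → ι (Y k l) = X k l) (k l : Fin n) :
    ι (oreDelta q Y p k l) = oreDelta q X p k l := by
  by_cases h : p.1 < k ∧ p.2 < l
  · rw [oreDelta_of_lt h.1 h.2, oreDelta_of_lt h.1 h.2, map_smul, map_mul,
      hι (mem_lexGT_of_eq h.2), hι (mem_lexGT_of_lt h.1)]
  · rw [oreDelta, oreDelta, if_neg h, if_neg h, map_zero]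

namespace IsQMatrixOn

variable {q : ℂ} {n : ℕ} {A : Type*} [Ring A] [Algebra ℂ A] {X : Matrix (Fin n) (Fin n) A}
  {p : Fin n × Fin n}

theorem map {U : Set (Fin n × Fin n)} (h : IsQMatrixOn q U X) {B : Type*} [Ring B] [Algebra ℂ B]
    (f : A →ₐ[ℂ] B) : IsQMatrixOn q U (X.map f) where
  diag i j k l hU hik hjl := by simpa using congrArg f (h.diag hU hik hjl)
  row i j l hjl := by simpa using congrArg f (h.row hjl)
  col i j k hik := by simpa using congrArg f (h.col hik)
  anti i j k l hik hlj := by simpa using congrArg f (h.anti hik hlj)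
  zero i j hU := by simpa using congrArg f (h.zero hU)

open Classical in
theorem restrict (h : IsQMatrixOn q (lexGE p) X) : IsQMatrixOn q (lexGT p)
    (fun k l => if (k, l) ∈ lexGT p then X k l else 0 : Matrix (Fin n) (Fin n) A) where
  diag i j k l hU hik hjl := by
    have hU' := lexGT_subset_lexGE p hU
    simp only [hU, mem_lexGT_of_mem_lexGE hU' hik, mem_lexGT_of_mem_lexGE_row hU' hjl, if_true,
      h.diag hU' hik hjl]
  row i j l hjl := by
    split_ifs <;> simp [h.row hjl]
  col i j k hik := by
    split_ifs <;> simp [h.col hik]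
  anti i j k l hik hlj := by
    split_ifs <;> simp [h.anti hik hlj]
  zero i j hU := if_neg hU

theorem mul_eq_oreScalar_smul_add_oreDelta (h : IsQMatrixOn q (lexGE p) X) {k l : Fin n}
    (hkl : (k, l) ∈ lexGT p) :
    X p.1 p.2 * X k l = oreScalar q p k l • (X k l * X p.1 p.2) + oreDelta q X p k l := by
  obtain hk | ⟨rfl, hl⟩ : p.1 < k ∨ p.1 = k ∧ p.2 < l := hkl
  · rcases lt_trichotomy p.2 l with hl | rfl | hl
    · rw [oreScalar_of_lt hk hl, oreDelta_of_lt hk hl, one_smul, h.diag (mem_lexGE_self p) hk hl]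
    · rw [oreScalar_right, oreDelta_right, add_zero, h.col hk]
    · rw [oreScalar_of_gt hk hl, oreDelta_of_gt hl, one_smul, add_zero, h.anti hk hl]
  · rw [oreScalar_left, oreDelta_left, add_zero, h.row hl]

theorem of_lexGT {Y : Matrix (Fin n) (Fin n) A} (hY : IsQMatrixOn q (lexGT p) Y)
    (hXY : ∀ ⦃k l⦄, (k, l) ∈ lexGT p → X k l = Y k l)
    (hX0 : ∀ ⦃k l⦄, (k, l) ∉ lexGE p → X k l = 0)
    (hp : ∀ ⦃k l⦄, (k, l) ∈ lexGT p →
      X p.1 p.2 * X k l = oreScalar q p k l • (X k l * X p.1 p.2) + oreDelta q X p k l) :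
    IsQMatrixOn q (lexGE p) X where
  diag i j k l hU hik hjl := by
    have hkl : (k, l) ∈ lexGT p := mem_lexGT_of_mem_lexGE hU hik
    obtain hij | ⟨rfl, rfl⟩ | hij := mem_lexGT_or_eq_or_notMem_lexGE p i j
    · rw [hXY hij, hXY hkl, hXY (mem_lexGT_of_mem_lexGE_row hU hjl),
        hXY (mem_lexGT_of_mem_lexGE hU hik), hY.diag hij hik hjl]
    · rw [hp hkl, oreScalar_of_lt hik hjl, oreDelta_of_lt hik hjl, one_smul]
    · exact absurd hU hij
  row i j l hjl := by
    obtain hij | ⟨rfl, rfl⟩ | hij := mem_lexGT_or_eq_or_notMem_lexGE p i j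
    · have hil := mem_lexGT_of_mem_lexGE_row (lexGT_subset_lexGE p hij) hjl
      rw [hXY hij, hXY hil, hY.row hjl]
    · rw [hp (mem_lexGT_of_eq hjl), oreScalar_left, oreDelta_left, add_zero]
    · simp [hX0 hij]
  col i j k hik := by
    obtain hij | ⟨rfl, rfl⟩ | hij := mem_lexGT_or_eq_or_notMem_lexGE p i j
    · rw [hXY hij, hXY (mem_lexGT_of_mem_lexGE (lexGT_subset_lexGE p hij) hik), hY.col hik]
    · rw [hp (mem_lexGT_of_lt hik), oreScalar_right, oreDelta_right, add_zero]
    · simp [hX0 hij]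
  anti i j k l hik hlj := by
    obtain hij | ⟨rfl, rfl⟩ | hij := mem_lexGT_or_eq_or_notMem_lexGE p i j
    · rw [hXY hij, hXY (mem_lexGT_of_mem_lexGE (lexGT_subset_lexGE p hij) hik), hY.anti hik hlj]
    · rw [hp (mem_lexGT_of_lt hik), oreScalar_of_gt hik hlj, oreDelta_of_gt hlj, one_smul, add_zero]
    · simp [hX0 hij]
  zero _ _ hU := hX0 hU

end IsQMatrixOn

/-- Left multiplication by constants on the polynomial ring. -/
def mulLeftC (R : Type*) [Ring R] [Algebra ℂ R] : R →ₐ[ℂ] Module.End ℂ R[X] :=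
  (Algebra.lmul ℂ R[X]).comp Polynomial.CAlgHom

theorem mulLeftC_apply {R : Type*} [Ring R] [Algebra ℂ R] (r : R) (f : R[X]) :
    mulLeftC R r f = C r * f := rfl

open Classical in
theorem IsTwistedDerivation.isQMatrixOn_lexGE {q : ℂ} {n : ℕ} {p : Fin n × Fin n} {R : Type*}
    [Ring R] [Algebra ℂ R] {τ : R →ₐ[ℂ] R} {δ : R →ₗ[ℂ] R} (hδ : IsTwistedDerivation τ δ)
    {Y : Matrix (Fin n) (Fin n) R} (hY : IsQMatrixOn q (lexGT p) Y)
    (hτY : ∀ k l, τ (Y k l) = oreScalar q p k l • Y k l)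
    (hδY : ∀ k l, δ (Y k l) = oreDelta q Y p k l) :
    IsQMatrixOn q (lexGE p) (fun k l => if (k, l) = p then oreMulX τ δ else mulLeftC R (Y k l) :
      Matrix (Fin n) (Fin n) (Module.End ℂ R[X])) := by
  set X : Matrix (Fin n) (Fin n) (Module.End ℂ R[X]) :=
    fun k l => if (k, l) = p then oreMulX τ δ else mulLeftC R (Y k l)
  have hXp : X p.1 p.2 = oreMulX τ δ := if_pos rfl
  have hXY : ∀ ⦃k l⦄, (k, l) ∈ lexGT p → mulLeftC R (Y k l) = X k l := fun k l hkl =>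
    (if_neg (ne_of_mem_of_not_mem hkl (notMem_lexGT_self p))).symm
  refine .of_lexGT (hY.map (mulLeftC R)) (fun k l hkl => (hXY hkl).symm) (fun k l hkl => ?_)
    fun k l hkl => ?_
  · rw [show X k l = mulLeftC R (Y k l) from
      if_neg (ne_of_mem_of_not_mem (mem_lexGE_self p) hkl).symm,
      hY.zero fun h => hkl (lexGT_subset_lexGE p h), map_zero]
  · rw [← map_oreDelta hXY, ← hδY, ← hXY hkl, hXp, ← smul_mul_assoc, ← map_smul, ← hτY]
    exact LinearMap.ext (hδ.oreMulX_C_mul (Y k l))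

/-- `A` is presented by the generators `X i j` and the relations `IsQMatrixOn q U`. -/
structure IsPresentedOn (q : ℂ) {n : ℕ} (U : Set (Fin n × Fin n)) {A : Type} [Ring A]
    [Algebra ℂ A] (X : Matrix (Fin n) (Fin n) A) : Prop where
  rel : IsQMatrixOn q U X
  adjoin : Algebra.adjoin ℂ (Set.range fun r : Fin n × Fin n => X r.1 r.2) = ⊤
  lift : ∀ {B : Type} [Ring B] [Algebra ℂ B] (Y : Matrix (Fin n) (Fin n) B), IsQMatrixOn q U Y →
    ∃ f : A →ₐ[ℂ] B, ∀ i j, f (X i j) = Y i j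

theorem adjoin_range_freeAlgebra_ι_eq_top {σ A : Type*} [Ring A] [Algebra ℂ A]
    {f : FreeAlgebra ℂ σ →ₐ[ℂ] A} (hf : Function.Surjective f) :
    Algebra.adjoin ℂ (Set.range fun r => f (FreeAlgebra.ι ℂ r)) = ⊤ := by
  rw [Set.range_comp' f (FreeAlgebra.ι ℂ), ← AlgHom.map_adjoin, FreeAlgebra.adjoin_range_ι,
    Algebra.map_top, (AlgHom.range_eq_top f).2 hf]

theorem exists_isPresentedOn (n : ℕ) (q : ℂ) (U : Set (Fin n × Fin n)) :
    ∃ (R : Type) (_ : Ring R) (_ : Algebra ℂ R) (X : Matrix (Fin n) (Fin n) R),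
      IsPresentedOn q U X := by
  let F {B : Type} [Ring B] [Algebra ℂ B] (Y : Matrix (Fin n) (Fin n) B) :
      FreeAlgebra ℂ (Fin n × Fin n) →ₐ[ℂ] B := FreeAlgebra.lift ℂ fun p => Y p.1 p.2
  let rel (a b : FreeAlgebra ℂ (Fin n × Fin n)) : Prop :=
    ∀ (B : Type) [Ring B] [Algebra ℂ B] (Y : Matrix (Fin n) (Fin n) B), IsQMatrixOn q U Y →
      F Y a = F Y b
  let mk := RingQuot.mkAlgHom ℂ rel
  have hF {B : Type} [Ring B] [Algebra ℂ B] (Y : Matrix (Fin n) (Fin n) B) (i j : Fin n) :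
      F Y (freeX n i j) = Y i j := by simp [F, freeX]
  have hmk {a b} (h : rel a b) : mk a = mk b := RingQuot.mkAlgHom_rel ℂ h
  refine ⟨RingQuot rel, inferInstance, inferInstance, fun i j => mk (freeX n i j),
    ⟨⟨fun i j k l hU hik hjl => ?_, fun i j l hjl => ?_, fun i j k hik => ?_,
      fun i j k l hik hlj => ?_, fun i j hU => ?_⟩,
      adjoin_range_freeAlgebra_ι_eq_top (RingQuot.mkAlgHom_surjective ℂ rel), fun {B} _ _ Y hY =>
      ⟨RingQuot.liftAlgHom ℂ ⟨F Y, fun a b h => h B Y hY⟩, fun i j => ?_⟩⟩⟩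
  · simp only [← map_mul, ← map_smul, ← map_add]
    exact hmk fun B _ _ Y hY => by simpa [hF] using hY.diag hU hik hjl
  · simp only [← map_mul, ← map_smul]
    exact hmk fun B _ _ Y hY => by simpa [hF] using hY.row hjl
  · simp only [← map_mul, ← map_smul]
    exact hmk fun B _ _ Y hY => by simpa [hF] using hY.col hik
  · simp only [← map_mul]
    exact hmk fun B _ _ Y hY => by simpa [hF] using hY.anti hik hlj
  · rw [← map_zero mk]
    exact hmk fun B _ _ Y hY => by simpa [hF] using hY.zero hU
  · rw [← hF Y]
    exact RingQuot.liftAlgHom_mkAlgHom_apply ℂ _ _ _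

/-- The homomorphism defined by a quantum matrix. -/
def OqM.lift {n : ℕ} {q : ℂ} {B : Type*} [Ring B] [Algebra ℂ B] (Y : Matrix (Fin n) (Fin n) B)
    (hY : IsQMatrix q Y) : OqM n q →ₐ[ℂ] B :=
  liftM (FreeAlgebra.lift ℂ fun p => Y p.1 p.2) <| by
    rintro _ _ (⟨i, j, k, l, hik, hjl⟩ | ⟨i, j, l, hjl⟩ | ⟨i, j, k, hik⟩ | ⟨i, j, k, l, hik, hlj⟩)
    · simpa [freeX] using hY.diag hik hjl
    · simpa [freeX] using hY.row hjl
    · simpa [freeX] using hY.col hik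
    · simpa [freeX] using hY.anti hik hlj

@[simp]
theorem OqM.lift_genX {n : ℕ} {q : ℂ} {B : Type*} [Ring B] [Algebra ℂ B]
    (Y : Matrix (Fin n) (Fin n) B) (hY : IsQMatrix q Y) (i j : Fin n) :
    OqM.lift Y hY (genX n q i j) = Y i j := by
  rw [OqM.lift, genX, liftM_mk]
  simp [freeX]

theorem adjoin_range_genX (n : ℕ) (q : ℂ) :
    Algebra.adjoin ℂ (Set.range fun r : Fin n × Fin n => genX n q r.1 r.2) = ⊤ :=
  adjoin_range_freeAlgebra_ι_eq_top (mkM_surjective n q)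

theorem isPresentedOn_genX (n : ℕ) (q : ℂ) : IsPresentedOn q Set.univ (genX n q) where
  rel := isQMatrixOn_univ.2 (isQMatrix_genX n q)
  adjoin := adjoin_range_genX n q
  lift Y hY := ⟨OqM.lift Y (isQMatrixOn_univ.1 hY), OqM.lift_genX Y _⟩

namespace IsPresentedOn

variable {q : ℂ} {n : ℕ} {U : Set (Fin n × Fin n)} {A : Type} [Ring A] [Algebra ℂ A]
  {X : Matrix (Fin n) (Fin n) A}

theorem hom_ext (h : IsPresentedOn q U X) {B : Type*} [Ring B] [Algebra ℂ B] {f g : A →ₐ[ℂ] B}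
    (hfg : ∀ i j, f (X i j) = g (X i j)) : f = g :=
  AlgHom.ext_of_adjoin_eq_top h.adjoin <| by
    rintro _ ⟨r, rfl⟩
    exact hfg r.1 r.2

theorem exists_scaling (h : IsPresentedOn q U X) {c : Fin n → Fin n → ℂ} (hc0 : ∀ i j, c i j ≠ 0)
    (hc : ∀ ⦃i j k l⦄, (i, j) ∈ U → i < k → j < l → c i l * c k j = c i j * c k l) :
    ∃ τ : A →ₐ[ℂ] A, Function.Injective τ ∧ ∀ i j, τ (X i j) = c i j • X i j := by
  obtain ⟨τ, hτ⟩ := h.lift _ (h.rel.smul c hc)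
  obtain ⟨τ', hτ'⟩ := h.lift _ (h.rel.smul (fun i j => (c i j)⁻¹) fun i j k l hU hik hjl => by
    rw [← mul_inv, hc hU hik hjl, mul_inv])
  have hinv : τ'.comp τ = AlgHom.id ℂ A := h.hom_ext fun i j => by simp [hτ, hτ', hc0]
  exact ⟨τ, Function.LeftInverse.injective (g := τ') fun a => DFunLike.congr_fun hinv a, hτ⟩

variable {p : Fin n × Fin n}

theorem exists_automorphism_derivation (h : IsPresentedOn q (lexGT p) X) (hq : q ≠ 0) :
    ∃ (τ : A →ₐ[ℂ] A) (δ : A →ₗ[ℂ] A), Function.Injective τ ∧ IsTwistedDerivation τ δ ∧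
      (∀ k l, τ (X k l) = oreScalar q p k l • X k l) ∧ ∀ k l, δ (X k l) = oreDelta q X p k l := by
  obtain ⟨τ, hinj, hτ⟩ := h.exists_scaling (c := oreScalar q p)
    (fun _ _ => oreScalar_ne_zero hq) fun _ _ _ _ hU hik hjl => oreScalar_mul_oreScalar hik hjl hU
  obtain ⟨Θ, hΘ⟩ := h.lift _ (isQMatrixOn_oreMatrix h.rel hq)
  obtain ⟨δ, hδ, hΘδ⟩ := exists_isTwistedDerivation h.adjoin (τ := τ) (Θ := Θ) <| by
    rintro _ ⟨r, rfl⟩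
    exact ⟨oreDelta q X p r.1 r.2, by rw [hΘ, hτ, oreMatrix]⟩
  refine ⟨τ, δ, hinj, hδ, hτ, fun k l => ?_⟩
  simpa [hΘ, oreMatrix] using (congrFun₂ (hΘδ (X k l)) 0 1).symm

variable {R : Type} [Ring R] [Algebra ℂ R] {Y : Matrix (Fin n) (Fin n) R}

theorem exists_inclusion (hX : IsPresentedOn q (lexGE p) X) (hY : IsPresentedOn q (lexGT p) Y) :
    ∃ ι : R →ₐ[ℂ] A, ∀ ⦃k l⦄, (k, l) ∈ lexGT p → ι (Y k l) = X k l := by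
  obtain ⟨ι, hι⟩ := hY.lift _ hX.rel.restrict
  exact ⟨ι, fun k l h => (hι k l).trans (if_pos h)⟩

theorem adjoin_insert_range_eq_top (hX : IsPresentedOn q (lexGE p) X) {ι : R →ₐ[ℂ] A}
    (hι : ∀ ⦃k l⦄, (k, l) ∈ lexGT p → ι (Y k l) = X k l) :
    Algebra.adjoin ℂ (insert (X p.1 p.2) (Set.range ι)) = ⊤ := by
  rw [eq_top_iff, ← hX.adjoin, Algebra.adjoin_le_iff]
  rintro _ ⟨⟨k, l⟩, rfl⟩
  obtain h | ⟨rfl, rfl⟩ | h := mem_lexGT_or_eq_or_notMem_lexGE p k l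
  · exact Algebra.subset_adjoin (Or.inr ⟨Y k l, hι h⟩)
  · exact Algebra.subset_adjoin (Or.inl rfl)
  · simp [hX.rel.zero h]

theorem exists_isOreExtension (hX : IsPresentedOn q (lexGE p) X)
    (hY : IsPresentedOn q (lexGT p) Y) (hq : q ≠ 0) :
    ∃ (ι : R →ₐ[ℂ] A) (τ : R →ₐ[ℂ] R) (δ : R →ₗ[ℂ] R), Function.Injective τ ∧
      (∀ ⦃k l⦄, (k, l) ∈ lexGT p → ι (Y k l) = X k l) ∧
      (∀ k l, τ (Y k l) = oreScalar q p k l • Y k l) ∧ IsOreExtension ι (X p.1 p.2) τ δ := by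
  obtain ⟨τ, δ, hinj, hδ, hτY, hδY⟩ := hY.exists_automorphism_derivation hq
  obtain ⟨ι, hι⟩ := hX.exists_inclusion hY
  obtain ⟨ρ, hρ⟩ := hX.lift _ (hδ.isQMatrixOn_lexGE hY.rel hτY hδY)
  have hρι : ρ.comp ι = mulLeftC R := hY.hom_ext fun k l => by
    by_cases hkl : (k, l) ∈ lexGT p
    · rw [AlgHom.comp_apply, hι hkl, hρ, if_neg (ne_of_mem_of_not_mem hkl (notMem_lexGT_self p))]
    · simp [hY.rel.zero hkl]
  have hcomm : ∀ r, X p.1 p.2 * ι r = ι (τ r) * X p.1 p.2 + ι (δ r) := by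
    refine comm_of_adjoin_eq_top hδ hY.adjoin ?_
    rintro _ ⟨⟨k, l⟩, rfl⟩
    rw [hτY, hδY, map_oreDelta hι]
    by_cases hkl : (k, l) ∈ lexGT p
    · rw [map_smul, hι hkl, hX.rel.mul_eq_oreScalar_smul_add_oreDelta hkl, smul_mul_assoc]
    · simp [hY.rel.zero hkl, oreDelta_of_notMem hkl]
  exact ⟨ι, τ, δ, hinj, hι, hτY, hcomm,
    oreEval_injective hδ ((hρ _ _).trans (if_pos rfl)) fun r => DFunLike.congr_fun <|
      (DFunLike.congr_fun hρι r :),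
    oreEval_surjective hcomm (hX.adjoin_insert_range_eq_top hι)⟩

theorem exists_algebraMap_eq (hX : IsPresentedOn q ∅ X) (a : A) : ∃ c, algebraMap ℂ A c = a := by
  have htop : (⊥ : Subalgebra ℂ A) = ⊤ := by
    rw [← hX.adjoin, eq_comm, eq_bot_iff, Algebra.adjoin_le_iff]
    rintro _ ⟨r, rfl⟩
    simp only [hX.rel.zero (Set.notMem_empty _), SetLike.mem_coe, zero_mem]
  exact Algebra.mem_bot.1 (htop ▸ Algebra.mem_top)

theorem noZeroDivisors_of_empty (hX : IsPresentedOn q ∅ X) : NoZeroDivisors A := by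
  obtain ⟨f, -⟩ := hX.lift (B := ℂ) 0 ⟨by simp, by simp, by simp, by simp, by simp⟩
  have hf : Function.Injective f := fun a b hab => by
    obtain ⟨c, rfl⟩ := hX.exists_algebraMap_eq a
    obtain ⟨d, rfl⟩ := hX.exists_algebraMap_eq b
    rw [AlgHom.commutes, AlgHom.commutes] at hab
    rw [show c = d from hab]
  exact hf.noZeroDivisors f (map_zero f) (map_mul f)

theorem noZeroDivisors_lexGE (hq : q ≠ 0) (p : Fin n ×ₗ Fin n) :
    ∀ {A : Type} [Ring A] [Algebra ℂ A] {X : Matrix (Fin n) (Fin n) A},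
      IsPresentedOn q (lexGE (ofLex p)) X → NoZeroDivisors A := by
  induction p using WellFoundedGT.induction with
  | ind p ih =>
  intro A _ _ X hX
  obtain ⟨R, _, _, Y, hY⟩ := exists_isPresentedOn n q (lexGT (ofLex p))
  have hR : NoZeroDivisors R := by
    obtain h | ⟨s, hs, h⟩ := lexGT_eq_empty_or_eq_lexGE (ofLex p)
    · exact (h ▸ hY).noZeroDivisors_of_empty
    · exact ih (toLex s) (mem_lexGT_iff.1 hs) (h ▸ hY)
  obtain ⟨ι, τ, δ, hτ, -, -, h⟩ := hX.exists_isOreExtension hY hq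
  exact h.noZeroDivisors hτ

end IsPresentedOn

theorem isPresentedOn_empty_genX (q : ℂ) : IsPresentedOn q ∅ (genX 0 q) :=
  Set.eq_empty_of_isEmpty (Set.univ : Set (Fin 0 × Fin 0)) ▸ isPresentedOn_genX 0 q

theorem isPresentedOn_lexGE_genX (n : ℕ) (q : ℂ) :
    IsPresentedOn q (lexGE (0, 0)) (genX (n + 1) q) :=
  univ_eq_lexGE n ▸ isPresentedOn_genX (n + 1) q

theorem OqM.noZeroDivisors (n : ℕ) {q : ℂ} (hq : q ≠ 0) : NoZeroDivisors (OqM n q) := by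
  cases n with
  | zero => exact (isPresentedOn_empty_genX q).noZeroDivisors_of_empty
  | succ n =>
    exact IsPresentedOn.noZeroDivisors_lexGE hq (toLex (0, 0)) (isPresentedOn_lexGE_genX n q)

/-! ### Restriction to the diagonal torus -/

theorem permLength_one (t : ℕ) : permLength (1 : Equiv.Perm (Fin t)) = 0 := by
  rw [permLength, Finset.card_eq_zero, Finset.filter_eq_empty_iff]
  exact fun p _ h => lt_asymm h.1 h.2

theorem sigmaM_one (n : ℕ) (q : ℂ) : sigmaM n q 1 = ∑ i, genX n q i i := by
  rw [sigmaM, qSigma]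
  symm
  refine Fintype.sum_bijective (fun i => ⟨{i}, Finset.card_singleton i⟩) ⟨fun i j h => ?_, ?_⟩ _ _
    fun i => ?_
  · simpa using h
  · rintro ⟨I, hI⟩
    obtain ⟨i, rfl⟩ := Finset.card_eq_one.1 hI
    exact ⟨i, rfl⟩
  · simp [qMinor, qDet, Subsingleton.elim _ (1 : Equiv.Perm (Fin 1)), permLength_one]

theorem isQMatrix_diagonal (q : ℂ) {n : ℕ} {A : Type*} [CommRing A] [Algebra ℂ A]
    (t : Fin n → A) : IsQMatrix q (Matrix.diagonal t) where
  diag i j k l hik hjl := by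
    have hoff : Matrix.diagonal t i l * Matrix.diagonal t k j = 0 := by
      simp only [Matrix.diagonal_apply]
      grind
    rw [hoff, smul_zero, add_zero, mul_comm]
  row i j l hjl := by
    simp only [Matrix.diagonal_apply]
    split_ifs with h h' <;> simp_all
  col i j k hik := by
    simp only [Matrix.diagonal_apply]
    split_ifs with h h' <;> simp_all
  anti i j k l _ _ := mul_comm _ _

/-- Restriction of functions to the diagonal torus. -/
def diagHom (n : ℕ) (q : ℂ) : OqM n q →ₐ[ℂ] MvPolynomial (Fin n) ℂ :=
  OqM.lift (Matrix.diagonal MvPolynomial.X) (isQMatrix_diagonal q _)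

theorem diagHom_genX (n : ℕ) (q : ℂ) (i j : Fin n) :
    diagHom n q (genX n q i j) = Matrix.diagonal MvPolynomial.X i j :=
  OqM.lift_genX _ _ i j

/-- The block diagonal matrix with blocks `t` and `Y`. -/
def blockDiag {n : ℕ} {A : Type*} [Ring A] (t : A) (Y : Matrix (Fin n) (Fin n) A) :
    Matrix (Fin (n + 1)) (Fin (n + 1)) A :=
  fun i j => Fin.cases (Fin.cases t (fun _ => 0) j) (fun i' => Fin.cases 0 (fun j' => Y i' j') j) i

section BlockDiag

variable {n : ℕ} {A : Type*} [Ring A] (t : A) (Y : Matrix (Fin n) (Fin n) A)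

@[simp] theorem blockDiag_zero_zero : blockDiag t Y 0 0 = t := rfl

@[simp] theorem blockDiag_zero_succ (j : Fin n) : blockDiag t Y 0 j.succ = 0 := rfl

@[simp] theorem blockDiag_succ_zero (i : Fin n) : blockDiag t Y i.succ 0 = 0 := rfl

@[simp] theorem blockDiag_succ_succ (i j : Fin n) : blockDiag t Y i.succ j.succ = Y i j := rfl

end BlockDiag

theorem IsQMatrix.blockDiag {q : ℂ} {n : ℕ} {A : Type*} [Ring A] [Algebra ℂ A] {t : A}
    {Y : Matrix (Fin n) (Fin n) A} (hY : IsQMatrix q Y) (ht : ∀ i j, Commute t (Y i j)) :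
    IsQMatrix q (blockDiag t Y) where
  diag i j k l hik hjl := by
    obtain ⟨k, rfl⟩ := Fin.exists_succ_eq.2 (Fin.ne_zero_of_lt hik)
    obtain ⟨l, rfl⟩ := Fin.exists_succ_eq.2 (Fin.ne_zero_of_lt hjl)
    cases i using Fin.cases <;> cases j using Fin.cases
    · simp [(ht k l).eq]
    · simp
    · simp
    · simpa using hY.diag (Fin.succ_lt_succ_iff.1 hik) (Fin.succ_lt_succ_iff.1 hjl)
  row i j l hjl := by
    obtain ⟨l, rfl⟩ := Fin.exists_succ_eq.2 (Fin.ne_zero_of_lt hjl)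
    cases i using Fin.cases <;> cases j using Fin.cases
    · simp
    · simp
    · simp
    · simpa using hY.row (Fin.succ_lt_succ_iff.1 hjl)
  col i j k hik := by
    obtain ⟨k, rfl⟩ := Fin.exists_succ_eq.2 (Fin.ne_zero_of_lt hik)
    cases i using Fin.cases <;> cases j using Fin.cases
    · simp
    · simp
    · simp
    · simpa using hY.col (Fin.succ_lt_succ_iff.1 hik)
  anti i j k l hik hlj := by
    obtain ⟨k, rfl⟩ := Fin.exists_succ_eq.2 (Fin.ne_zero_of_lt hik)
    obtain ⟨j, rfl⟩ := Fin.exists_succ_eq.2 (Fin.ne_zero_of_lt hlj)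
    cases i using Fin.cases <;> cases l using Fin.cases
    · simp
    · simp
    · simp
    · simpa using hY.anti (Fin.succ_lt_succ_iff.1 hik) (Fin.succ_lt_succ_iff.1 hlj)

theorem isQMatrix_genX_map_C (n : ℕ) (q : ℂ) :
    IsQMatrix q ((genX n q).map (C : OqM n q →+* (OqM n q)[X])) :=
  isQMatrixOn_univ.1 ((isPresentedOn_genX n q).rel.map (CAlgHom : OqM n q →ₐ[ℂ] (OqM n q)[X]))

/-- Restriction of functions to block diagonal matrices with blocks of sizes `1` and `n`. -/
def blockHom (n : ℕ) (q : ℂ) : OqM (n + 1) q →ₐ[ℂ] (OqM n q)[X] :=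
  OqM.lift (blockDiag X ((genX n q).map C)) <|
    (isQMatrix_genX_map_C n q).blockDiag fun _ _ => commute_X _

theorem blockHom_genX (n : ℕ) (q : ℂ) (i j : Fin (n + 1)) :
    blockHom n q (genX (n + 1) q i j) = blockDiag X ((genX n q).map C) i j :=
  OqM.lift_genX _ _ i j

theorem blockHom_sigmaM_one (n : ℕ) (q : ℂ) :
    blockHom n q (sigmaM (n + 1) q 1) = X + C (sigmaM n q 1) := by
  simp [sigmaM_one, Fin.sum_univ_succ, blockHom_genX]

theorem finSuccEquiv_diagHom (n : ℕ) (q : ℂ) (a : OqM (n + 1) q) :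
    MvPolynomial.finSuccEquiv ℂ n (diagHom (n + 1) q a) =
      Polynomial.map (diagHom n q : OqM n q →+* MvPolynomial (Fin n) ℂ) (blockHom n q a) := by
  have hcomp : ((MvPolynomial.finSuccEquiv ℂ n).toAlgHom.comp (diagHom (n + 1) q)) =
      (Polynomial.mapAlgHom (diagHom n q)).comp (blockHom n q) := by
    refine (isPresentedOn_genX (n + 1) q).hom_ext fun i j => ?_
    cases i using Fin.cases with
    | zero =>
      cases j using Fin.cases with
      | zero => simp [diagHom_genX, blockHom_genX, MvPolynomial.finSuccEquiv_X_zero]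
      | succ j => simp [diagHom_genX, blockHom_genX, (Fin.succ_ne_zero _).symm]
    | succ i =>
      cases j using Fin.cases with
      | zero => simp [diagHom_genX, blockHom_genX]
      | succ j =>
        obtain rfl | h := eq_or_ne i j
        · simp [diagHom_genX, blockHom_genX, MvPolynomial.finSuccEquiv_X_succ]
        · simp [diagHom_genX, blockHom_genX, h]
  exact DFunLike.congr_fun hcomp a

/-! ### Fixed points of a diagonalizable endomorphism -/

theorem eq_zero_of_mem_iSup_eigenspace {𝕜 V κ : Type*} [Field 𝕜] [AddCommGroup V] [Module 𝕜 V]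
    {T : Module.End 𝕜 V} {μ : 𝕜} {ν : κ → 𝕜} (hν : ∀ d, ν d ≠ μ) {v : V} (hv : T v = μ • v)
    (hv' : v ∈ ⨆ d, T.eigenspace (ν d)) : v = 0 :=
  (Submodule.disjoint_def.1 (T.eigenspaces_iSupIndep μ)) v (Module.End.mem_eigenspace_iff.2 hv) <|
    (iSup_le fun d => le_iSup₂_of_le (ν d) (hν d) le_rfl :
      ⨆ d, T.eigenspace (ν d) ≤ ⨆ (ν) (_ : ν ≠ μ), T.eigenspace ν) hv'

section FixedPoints

variable {𝕜 A B : Type*} [Field 𝕜] [Ring A] [Algebra 𝕜 A] [Ring B] [Algebra 𝕜 B] {q : 𝕜}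
  {τ : A →ₐ[𝕜] A}

theorem mul_mem_iSup_eigenspace_pow {y : A} {k : ℕ} (hy : τ y = q ^ k • y) {a : A}
    (ha : a ∈ ⨆ d : ℕ, Module.End.eigenspace τ.toLinearMap (q ^ (d + 1))) :
    y * a ∈ ⨆ d : ℕ, Module.End.eigenspace τ.toLinearMap (q ^ (d + 1)) := by
  suffices (⨆ d : ℕ, Module.End.eigenspace τ.toLinearMap (q ^ (d + 1))).map
      (LinearMap.mulLeft 𝕜 y) ≤ ⨆ d : ℕ, Module.End.eigenspace τ.toLinearMap (q ^ (d + 1)) from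
    this ⟨a, ha, rfl⟩
  rw [Submodule.map_iSup]
  refine iSup_le fun d => ?_
  rintro _ ⟨a, ha, rfl⟩
  have ha' : τ a = q ^ (d + 1) • a := Module.End.mem_eigenspace_iff.1 ha
  refine Submodule.mem_iSup_of_mem (k + d) (Module.End.mem_eigenspace_iff.2 ?_)
  rw [LinearMap.mulLeft_apply, AlgHom.toLinearMap_apply, map_mul, hy, ha', smul_mul_smul_comm,
    ← pow_add, add_assoc]

theorem mem_range_of_fixed {e : B →ₐ[𝕜] A} {s : Set A} (hs : Algebra.adjoin 𝕜 s = ⊤)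
    (hq : ∀ m : ℕ, 0 < m → q ^ m ≠ 1) (hτe : ∀ c, τ (e c) = e c)
    (hτs : ∀ x ∈ s, x ∈ e.range ∨ τ x = q • x) {b : A} (hb : τ b = b) : b ∈ e.range := by
  set V : Submodule 𝕜 A := ⨆ d : ℕ, Module.End.eigenspace τ.toLinearMap (q ^ (d + 1))
  have htop : LinearMap.range e.toLinearMap ⊔ V = ⊤ := by
    refine submodule_eq_top_of_mul_mem hs (Submodule.mem_sup_left ⟨1, map_one e⟩)
      fun x hx a ha => ?_
    obtain ⟨_, ⟨c, rfl⟩, v, hv, rfl⟩ := Submodule.mem_sup.1 ha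
    rw [AlgHom.toLinearMap_apply, mul_add]
    obtain ⟨d, rfl⟩ | hτx := hτs x hx
    · exact Submodule.add_mem_sup ⟨d * c, map_mul e d c⟩
        (mul_mem_iSup_eigenspace_pow (k := 0) (by rw [pow_zero, one_smul]; exact hτe d) hv)
    · refine Submodule.mem_sup_right (V.add_mem ?_
        (mul_mem_iSup_eigenspace_pow (k := 1) (by rwa [pow_one]) hv))
      refine Submodule.mem_iSup_of_mem 0 (Module.End.mem_eigenspace_iff.2 ?_)
      rw [AlgHom.toLinearMap_apply, map_mul, hτe, hτx, zero_add, pow_one, smul_mul_assoc]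
  obtain ⟨_, ⟨c, rfl⟩, v, hv, rfl⟩ := Submodule.mem_sup.1 (htop ▸ Submodule.mem_top : b ∈ _)
  have hτv : τ v = v := by
    rw [map_add, AlgHom.toLinearMap_apply, hτe] at hb
    exact add_left_cancel hb
  have hv0 : v = 0 := eq_zero_of_mem_iSup_eigenspace (T := τ.toLinearMap) (μ := 1)
    (fun d => hq (d + 1) d.succ_pos) (by rw [one_smul]; exact hτv) hv
  rw [hv0, add_zero]
  exact ⟨c, rfl⟩

end FixedPoints

/-! ### Injectivity of the diagonal restriction on the centralizer of `σ₁` -/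

theorem mem_lexGT_zero_iff {n : ℕ} {i j : Fin (n + 1)} :
    (i, j) ∈ lexGT ((0 : Fin (n + 1)), (0 : Fin (n + 1))) ↔ i ≠ 0 ∨ j ≠ 0 := by
  simp only [lexGT, Set.mem_ofPred_eq, Fin.pos_iff_ne_zero]
  grind

theorem succ_succ_mem_lexGT_zero {n : ℕ} (i j : Fin n) :
    (i.succ, j.succ) ∈ lexGT ((0 : Fin (n + 1)), (0 : Fin (n + 1))) :=
  mem_lexGT_of_lt i.succ_pos

theorem IsQMatrixOn.submatrix_succ {q : ℂ} {n : ℕ} {A : Type*} [Ring A] [Algebra ℂ A]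
    {Y : Matrix (Fin (n + 1)) (Fin (n + 1)) A} (hY : IsQMatrixOn q (lexGT (0, 0)) Y) :
    IsQMatrix q (Y.submatrix Fin.succ Fin.succ) where
  diag i j _ _ hik hjl := hY.diag (succ_succ_mem_lexGT_zero i j) (Fin.succ_lt_succ_iff.2 hik)
    (Fin.succ_lt_succ_iff.2 hjl)
  row _ _ _ hjl := hY.row (Fin.succ_lt_succ_iff.2 hjl)
  col _ _ _ hik := hY.col (Fin.succ_lt_succ_iff.2 hik)
  anti _ _ _ _ hik hlj := hY.anti (Fin.succ_lt_succ_iff.2 hik) (Fin.succ_lt_succ_iff.2 hlj)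

namespace IsPresentedOn

variable {n : ℕ} {q : ℂ} {R : Type} [Ring R] [Algebra ℂ R]
  {Y : Matrix (Fin (n + 1)) (Fin (n + 1)) R}

theorem exists_blockRestriction (hY : IsPresentedOn q (lexGT (0, 0)) Y) :
    ∃ r : R →ₐ[ℂ] OqM n q, ∀ i j, r (Y i j) = blockDiag 0 (genX n q) i j :=
  hY.lift _ <| ((isQMatrix_genX n q).blockDiag fun _ _ => Commute.zero_left _).isQMatrixOn
    fun i j h => by
      obtain ⟨rfl, rfl⟩ : i = 0 ∧ j = 0 := by simpa [mem_lexGT_zero_iff] using h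
      rfl

theorem blockHom_comp (hY : IsPresentedOn q (lexGT (0, 0)) Y) {ι : R →ₐ[ℂ] OqM (n + 1) q}
    (hι : ∀ ⦃k l⦄, (k, l) ∈ lexGT (0, 0) → ι (Y k l) = genX (n + 1) q k l)
    {r : R →ₐ[ℂ] OqM n q} (hr : ∀ i j, r (Y i j) = blockDiag 0 (genX n q) i j) :
    (blockHom n q).comp ι = CAlgHom.comp r := hY.hom_ext fun k l => by
  by_cases hkl : (k, l) ∈ lexGT ((0 : Fin (n + 1)), (0 : Fin (n + 1)))
  · rw [AlgHom.comp_apply, hι hkl, blockHom_genX, AlgHom.comp_apply, hr]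
    cases k using Fin.cases <;> cases l using Fin.cases
    · exact (notMem_lexGT_self _ hkl).elim
    all_goals simp
  · simp [hY.rel.zero hkl]

theorem eq_zero_of_fixed (hY : IsPresentedOn q (lexGT (0, 0)) Y)
    (hq : ∀ m : ℕ, 0 < m → q ^ m ≠ 1) {τ : R →ₐ[ℂ] R}
    (hτ : ∀ k l, τ (Y k l) = oreScalar q (0, 0) k l • Y k l) {r : R →ₐ[ℂ] OqM n q}
    (hr : ∀ i j, r (Y i j) = blockDiag 0 (genX n q) i j) {b : R} (hb : τ b = b) (hrb : r b = 0) :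
    b = 0 := by
  let e : OqM n q →ₐ[ℂ] R := OqM.lift _ hY.rel.submatrix_succ
  have he (i j) : e (genX n q i j) = Y i.succ j.succ := OqM.lift_genX _ _ i j
  have hre : r.comp e = AlgHom.id ℂ _ := (isPresentedOn_genX n q).hom_ext fun i j => by
    simp [he, hr]
  have hτe : τ.comp e = e := (isPresentedOn_genX n q).hom_ext fun i j => by
    simp [he, hτ, oreScalar, Fin.succ_ne_zero]
  obtain ⟨c, rfl⟩ : b ∈ e.range := by
    refine mem_range_of_fixed hY.adjoin hq (DFunLike.congr_fun hτe) ?_ hb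
    rintro _ ⟨⟨i, j⟩, rfl⟩
    by_cases h : i = 0 ∨ j = 0
    · exact Or.inr (by rw [hτ, oreScalar, if_pos h])
    · rw [not_or] at h
      obtain ⟨i, rfl⟩ := Fin.exists_succ_eq.2 h.1
      obtain ⟨j, rfl⟩ := Fin.exists_succ_eq.2 h.2
      exact Or.inl ⟨genX n q i j, he i j⟩
  have hc : c = 0 := (DFunLike.congr_fun hre c).symm.trans hrb
  rw [hc]
  exact map_zero e

end IsPresentedOn

theorem commute_coeff_of_commute_X_add_C {A : Type*} [Ring A] {f : A[X]} {s : A}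
    (h : Commute f (X + C s)) (k : ℕ) : Commute (f.coeff k) s := by
  have hC : Commute f (C s) := by simpa using h.sub_right (commute_X f).symm
  simpa only [commute_iff_eq, coeff_mul_C, coeff_C_mul] using congrArg (fun g => g.coeff k) hC.eq

theorem blockHom_oreEval {n : ℕ} {q : ℂ} {R : Type*} [Ring R] [Algebra ℂ R]
    {ι : R →ₐ[ℂ] OqM (n + 1) q} {r : R →ₐ[ℂ] OqM n q}
    (h : (blockHom n q).comp ι = CAlgHom.comp r) (f : R[X]) :
    blockHom n q (oreEval ι (genX (n + 1) q 0 0) f) = f.map (r : R →+* OqM n q) := by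
  have hs (s : R) : blockHom n q (ι s) = C (r s) := DFunLike.congr_fun h s
  induction f using Polynomial.induction_on' with
  | add f g hf hg => rw [map_add, map_add, hf, hg, Polynomial.map_add]
  | monomial k s =>
    rw [oreEval_monomial, map_mul, map_pow, blockHom_genX, hs]
    simp [C_mul_X_pow_eq_monomial]

theorem diagHom_coeff_blockHom_eq_zero {n : ℕ} {q : ℂ} {a : OqM (n + 1) q}
    (ha : diagHom (n + 1) q a = 0) (k : ℕ) : diagHom n q ((blockHom n q a).coeff k) = 0 := by
  have h := finSuccEquiv_diagHom n q a
  rw [ha, map_zero] at h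
  simpa [eq_comm] using congrArg (fun g => g.coeff k) h

theorem eq_zero_of_diagHom_eq_zero {n : ℕ} {q : ℂ} (hq0 : q ≠ 0)
    (hq : ∀ m : ℕ, 0 < m → q ^ m ≠ 1) {a : OqM n q} (ha : Commute a (sigmaM n q 1))
    (hD : diagHom n q a = 0) : a = 0 := by
  induction n with
  | zero =>
    obtain ⟨c, rfl⟩ := (isPresentedOn_empty_genX q).exists_algebraMap_eq a
    rw [AlgHom.commutes] at hD
    rw [(map_eq_zero _).1 hD, map_zero]
  | succ n ih =>
    obtain ⟨R, _, _, Y, hY⟩ := exists_isPresentedOn (n + 1) q (lexGT (0, 0))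
    obtain ⟨ι, τ, δ, -, hι, hτ, hO⟩ := (isPresentedOn_lexGE_genX n q).exists_isOreExtension hY hq0
    obtain ⟨r, hr⟩ := hY.exists_blockRestriction
    obtain ⟨f, rfl⟩ := hO.bijective.2 a
    have hblock := blockHom_oreEval (hY.blockHom_comp hι hr) f
    have hσ : sigmaM (n + 1) q 1 = genX (n + 1) q 0 0 + ι (∑ i : Fin n, Y i.succ i.succ) := by
      rw [sigmaM_one, Fin.sum_univ_succ, map_sum]
      simp only [hι (succ_succ_mem_lexGT_zero _ _)]
    have hfix : τ f.leadingCoeff = f.leadingCoeff := hO.map_leadingCoeff_of_commute (hσ ▸ ha)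
    have hcoeff : (f.map (r : R →+* OqM n q)).coeff f.natDegree = r f.leadingCoeff := by
      rw [coeff_map, AlgHom.coe_toRingHom, coeff_natDegree]
    have hr0 : r f.leadingCoeff = 0 := by
      rw [← hcoeff, ← hblock]
      refine ih (commute_coeff_of_commute_X_add_C ?_ _) (diagHom_coeff_blockHom_eq_zero hD _)
      rw [← blockHom_sigmaM_one]
      exact ha.map (blockHom n q)
    rw [leadingCoeff_eq_zero.1 (hY.eq_zero_of_fixed hq hτ hr hfix hr0), map_zero]

/-! ### Restriction to the diagonal torus and symmetric polynomials -/

theorem mem_centralizer_singleton_iff {A : Type*} [Ring A] [Algebra ℂ A] {a s : A} :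
    a ∈ Subalgebra.centralizer ℂ {s} ↔ Commute a s := by
  simp only [Subalgebra.mem_centralizer_iff, Set.mem_singleton_iff, forall_eq]
  exact eq_comm

theorem qDet_diagonal (q : ℂ) {t : ℕ} {A : Type*} [CommRing A] [Algebra ℂ A] (d : Fin t → A) :
    qDet q (Matrix.diagonal d) = ∏ i, d i := by
  rw [qDet, Finset.sum_eq_single 1]
  · simp [permLength_one, List.prod_ofFn]
  · intro s _ hs
    obtain ⟨a, ha⟩ : ∃ a, s a ≠ a := by
      by_contra! h
      exact hs (Equiv.ext h)
    rw [List.prod_ofFn, Finset.prod_eq_zero (Finset.mem_univ a), smul_zero]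
    exact Matrix.diagonal_apply_ne d ha.symm
  · simp

theorem diagHom_qMinor_self (n : ℕ) (q : ℂ) {t : ℕ} (I : Finset (Fin n)) (hI : I.card = t) :
    diagHom n q (qMinor q (genX n q) I I hI hI) = ∏ i ∈ I, MvPolynomial.X i := by
  have hX : (fun i j => diagHom n q ((genX n q).submatrix (I.orderEmbOfFin hI)
      (I.orderEmbOfFin hI) i j)) =
      Matrix.diagonal fun i => MvPolynomial.X (R := ℂ) (I.orderEmbOfFin hI i) := by
    ext1 i
    ext1 j
    rw [Matrix.submatrix_apply, diagHom_genX]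
    simp [Matrix.diagonal_apply]
  rw [qMinor, map_qDet, hX, qDet_diagonal]
  conv_rhs => rw [← Finset.map_orderEmbOfFin_univ I hI, Finset.prod_map]
  rfl

theorem diagHom_sigmaM (n : ℕ) (q : ℂ) (t : ℕ) :
    diagHom n q (sigmaM n q t) = MvPolynomial.esymm (Fin n) ℂ t := by
  rw [sigmaM, qSigma, map_sum, MvPolynomial.esymm_eq_sum_subtype]
  exact Finset.sum_congr rfl fun I _ => diagHom_qMinor_self n q I.1 I.2

theorem diagHom_detM_ne_zero (n : ℕ) (q : ℂ) : diagHom n q (detM n q) ≠ 0 := by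
  have huniv : Finset.powersetCard n (Finset.univ : Finset (Fin n)) = {Finset.univ} := by
    simpa using Finset.powersetCard_self (Finset.univ : Finset (Fin n))
  rw [← sigmaM_self, diagHom_sigmaM, MvPolynomial.esymm, huniv, Finset.sum_singleton]
  exact Finset.prod_ne_zero_iff.2 fun i _ => MvPolynomial.X_ne_zero i

theorem detM_ne_zero (n : ℕ) (q : ℂ) : detM n q ≠ 0 := fun h =>
  diagHom_detM_ne_zero n q (by rw [h, map_zero])

/-- The subalgebra `ℂ⟨σ₁, …, σₙ⟩` generated by the sums of principal quantum minors. -/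
def sigmaAlg (n : ℕ) (q : ℂ) : Subalgebra ℂ (OqM n q) :=
  Algebra.adjoin ℂ {y | ∃ i, 1 ≤ i ∧ i ≤ n ∧ y = sigmaM n q i}

theorem sigmaM_mem_sigmaAlg {n : ℕ} (q : ℂ) {i : ℕ} (h1 : 1 ≤ i) (hn : i ≤ n) :
    sigmaM n q i ∈ sigmaAlg n q :=
  Algebra.subset_adjoin ⟨i, h1, hn, rfl⟩

theorem sigmaAlg_le_iff {n : ℕ} {q : ℂ} {S : Subalgebra ℂ (OqM n q)} :
    sigmaAlg n q ≤ S ↔ ∀ i, 1 ≤ i → i ≤ n → sigmaM n q i ∈ S := by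
  refine ⟨fun h i h1 hi => h (sigmaM_mem_sigmaAlg q h1 hi), fun h => Algebra.adjoin_le ?_⟩
  rintro _ ⟨i, h1, hi, rfl⟩
  exact h i h1 hi

theorem detM_mem_sigmaAlg {n : ℕ} (hn : 1 ≤ n) (q : ℂ) : detM n q ∈ sigmaAlg n q := by
  rw [← sigmaM_self]
  exact sigmaM_mem_sigmaAlg q hn le_rfl

theorem map_diagHom_sigmaAlg (n : ℕ) (q : ℂ) :
    (sigmaAlg n q).map (diagHom n q) = MvPolynomial.symmetricSubalgebra (Fin n) ℂ := by
  refine le_antisymm (Subalgebra.map_le.2 (sigmaAlg_le_iff.2 fun i _ _ => ?_)) fun f hf => ?_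
  · rw [Subalgebra.mem_comap, diagHom_sigmaM]
    exact MvPolynomial.esymm_isSymmetric _ _ _
  · obtain ⟨p, hp⟩ := MvPolynomial.esymmAlgHom_fin_surjective (n := n) ℂ le_rfl ⟨f, hf⟩
    have hf' :
        MvPolynomial.aeval (fun i : Fin n => MvPolynomial.esymm (Fin n) ℂ (i + 1)) p = f := by
      rw [← MvPolynomial.esymmAlgHom_apply, hp]
    have hle : (MvPolynomial.aeval fun i : Fin n => MvPolynomial.esymm (Fin n) ℂ (i + 1)).range ≤
        (sigmaAlg n q).map (diagHom n q) := by
      rw [← Algebra.adjoin_range_eq_range_aeval]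
      refine Algebra.adjoin_le ?_
      rintro _ ⟨i, rfl⟩
      exact ⟨_, sigmaM_mem_sigmaAlg q i.val.succ_pos i.2, diagHom_sigmaM n q _⟩
    exact hf' ▸ hle ⟨p, rfl⟩

theorem isSymmetric_diagHom {n : ℕ} {q : ℂ} {a : OqM n q} (ha : a ∈ sigmaAlg n q) :
    (diagHom n q a).IsSymmetric :=
  (map_diagHom_sigmaAlg n q).le ⟨a, ha, rfl⟩

theorem centralizer_eq_sigmaAlg_iff {n : ℕ} {q : ℂ} (hq0 : q ≠ 0)
    (hq : ∀ m : ℕ, 0 < m → q ^ m ≠ 1) :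
    Subalgebra.centralizer ℂ {sigmaM n q 1} = sigmaAlg n q ↔
      (∀ i, 1 ≤ i → i ≤ n → Commute (sigmaM n q i) (sigmaM n q 1)) ∧
        ∀ a, Commute a (sigmaM n q 1) → (diagHom n q a).IsSymmetric := by
  simp only [← mem_centralizer_singleton_iff]
  rw [← sigmaAlg_le_iff]
  refine ⟨fun h => ⟨h.ge, fun a ha => isSymmetric_diagHom (h ▸ ha)⟩, fun ⟨hσ, hD⟩ =>
    le_antisymm (fun a ha => ?_) hσ⟩
  obtain ⟨s, hs, hsa⟩ := (map_diagHom_sigmaAlg n q).ge (hD a ha)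
  have has : a - s = 0 := eq_zero_of_diagHom_eq_zero hq0 hq
    (mem_centralizer_singleton_iff.1 (sub_mem ha (hσ hs))) <| by
      rw [map_sub, sub_eq_zero]
      exact hsa.symm
  rw [sub_eq_zero.1 has]
  exact hs

/-! ### Localization at the quantum determinant -/

theorem toGL_injective (n : ℕ) {q : ℂ} (hq : q ≠ 0) : Function.Injective (toGL n q) := by
  have hdom := OqM.noZeroDivisors n hq
  let S := Submonoid.powers (detM n q)
  have hcomm : ∀ (s : S) (a : OqM n q), (s : OqM n q) * a = a * s := by
    rintro ⟨_, k, rfl⟩ a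
    exact ((commute_detM hq a).pow_left k).eq
  let _ : OreLocalization.OreSet S :=
    { ore_right_cancel := fun r₁ r₂ s h => ⟨s, by rw [hcomm, hcomm, h]⟩
      oreNum := fun r _ => r
      oreDenom := fun _ s => s
      ore_eq := fun r s => hcomm s r }
  let f : OqM n q →ₐ[ℂ] OreLocalization S (OqM n q) :=
    { OreLocalization.numeratorRingHom with commutes' := fun _ => rfl }
  have hf : Function.Injective f := by
    refine OreLocalization.numeratorHom_inj ?_
    rintro _ ⟨k, rfl⟩ a ha
    exact (mul_eq_zero.1 ha).resolve_left (pow_ne_zero k (detM_ne_zero n q))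
  obtain ⟨g, hg, -⟩ := existsUnique_lift_GL n q f
    (OreLocalization.numerator_isUnit (⟨detM n q, 1, pow_one _⟩ : S))
  intro a b hab
  refine hf ?_
  rw [← hg, AlgHom.comp_apply, hab, AlgHom.comp_apply]

theorem commute_toGL_iff {n : ℕ} {q : ℂ} (hq : q ≠ 0) {a b : OqM n q} :
    Commute (toGL n q a) (toGL n q b) ↔ Commute a b :=
  ⟨fun h => toGL_injective n hq (by simpa only [map_mul] using h.eq), fun h => h.map _⟩

theorem eq_top_of_toGL_mem_of_detInv_mem {n : ℕ} {q : ℂ} {S : Subalgebra ℂ (OqGL n q)}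
    (h : ∀ a, toGL n q a ∈ S) (hinv : detInv n q ∈ S) : S = ⊤ := by
  rw [eq_top_iff, ← adjoin_range_freeAlgebra_ι_eq_top (mkGL_surjective n q)]
  refine Algebra.adjoin_le ?_
  rintro _ ⟨_ | p, rfl⟩
  · exact hinv
  · have hp : toGL n q (mkM n q (FreeAlgebra.ι ℂ p)) = mkGL n q (FreeAlgebra.ι ℂ (some p)) := by
      rw [toGL_mkM, freeIncl, FreeAlgebra.lift_ι_apply]
    exact Set.mem_of_eq_of_mem hp.symm (h _)

theorem commute_detInv_toGL_detM (n : ℕ) (q : ℂ) : Commute (detInv n q) (toGL n q (detM n q)) :=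
  (detInv_mul_toGL_detM n q).trans (toGL_detM_mul_detInv n q).symm

theorem commute_toGL_detM {n : ℕ} {q : ℂ} (hq : q ≠ 0) (x : OqGL n q) :
    Commute x (toGL n q (detM n q)) := by
  have h := eq_top_of_toGL_mem_of_detInv_mem (S := Subalgebra.centralizer ℂ {toGL n q (detM n q)})
    (fun a => mem_centralizer_singleton_iff.2 ((commute_detM hq a).symm.map _))
    (mem_centralizer_singleton_iff.2 (commute_detInv_toGL_detM n q))
  exact mem_centralizer_singleton_iff.1 (h ▸ Algebra.mem_top)

theorem mul_toGL_detM_pow_mul_detInv_pow {n : ℕ} {q : ℂ} (x : OqGL n q) (k : ℕ) :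
    x * toGL n q (detM n q) ^ k * detInv n q ^ k = x := by
  rw [mul_assoc, ← (commute_detInv_toGL_detM n q).symm.mul_pow, toGL_detM_mul_detInv, one_pow,
    mul_one]

/-- The localization `S[det_q⁻¹]` of a subalgebra `S` that contains `det_q`, as the subalgebra of
the fractions with numerator in `S`. -/
def localizedSubalgebra {n : ℕ} {q : ℂ} (hq : q ≠ 0) (S : Subalgebra ℂ (OqM n q))
    (hS : detM n q ∈ S) : Subalgebra ℂ (OqGL n q) where
  carrier := {x | ∃ k : ℕ, ∃ s ∈ S, x * toGL n q (detM n q) ^ k = toGL n q s}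
  mul_mem' := by
    rintro x y ⟨k, s, hs, hx⟩ ⟨l, r, hr, hy⟩
    refine ⟨k + l, s * r, S.mul_mem hs hr, ?_⟩
    rw [pow_add, mul_assoc, ← mul_assoc y, ((commute_toGL_detM hq y).pow_right k).eq, mul_assoc,
      hy, ← mul_assoc, hx, map_mul]
  add_mem' := by
    rintro x y ⟨k, s, hs, hx⟩ ⟨l, r, hr, hy⟩
    refine ⟨k + l, s * detM n q ^ l + r * detM n q ^ k,
      S.add_mem (S.mul_mem hs (S.pow_mem hS l)) (S.mul_mem hr (S.pow_mem hS k)), ?_⟩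
    rw [map_add, map_mul, map_mul, map_pow, map_pow, ← hx, ← hy, mul_assoc, mul_assoc, ← pow_add,
      ← pow_add, add_comm l k, add_mul]
  algebraMap_mem' r := ⟨0, algebraMap ℂ _ r, S.algebraMap_mem r, by simp⟩

section

variable {n : ℕ} {q : ℂ} (hq : q ≠ 0) {S : Subalgebra ℂ (OqM n q)} (hS : detM n q ∈ S)

theorem toGL_mem_localizedSubalgebra {s : OqM n q} (hs : s ∈ S) :
    toGL n q s ∈ localizedSubalgebra hq S hS :=
  ⟨0, s, hs, by simp⟩

theorem detInv_mem_localizedSubalgebra : detInv n q ∈ localizedSubalgebra hq S hS :=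
  ⟨1, 1, S.one_mem, by rw [pow_one, detInv_mul_toGL_detM, map_one]⟩

theorem exists_mul_detM_pow_mem {a : OqM n q} (ha : toGL n q a ∈ localizedSubalgebra hq S hS) :
    ∃ k : ℕ, a * detM n q ^ k ∈ S := by
  obtain ⟨k, s, hs, h⟩ := ha
  rw [← map_pow, ← map_mul] at h
  exact ⟨k, toGL_injective n hq h ▸ hs⟩

theorem localizedSubalgebra_top : localizedSubalgebra hq (n := n) ⊤ Algebra.mem_top = ⊤ :=
  eq_top_of_toGL_mem_of_detInv_mem (fun _ => toGL_mem_localizedSubalgebra hq _ Algebra.mem_top)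
    (detInv_mem_localizedSubalgebra hq _)

theorem localizedSubalgebra_le {T : Subalgebra ℂ (OqGL n q)} (h : S.map (toGL n q) ≤ T)
    (hinv : detInv n q ∈ T) : localizedSubalgebra hq S hS ≤ T := by
  rintro x ⟨k, s, hs, hx⟩
  rw [← mul_toGL_detM_pow_mul_detInv_pow x k, hx]
  exact mul_mem (h ⟨s, hs, rfl⟩) (pow_mem hinv k)

end

theorem centralizer_toGL {n : ℕ} {q : ℂ} (hq : q ≠ 0) (s : OqM n q) :
    Subalgebra.centralizer ℂ {toGL n q s} = localizedSubalgebra hq (Subalgebra.centralizer ℂ {s})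
      (mem_centralizer_singleton_iff.2 (commute_detM hq s)) := by
  refine le_antisymm (fun x hx => ?_) (localizedSubalgebra_le hq _ ?_ ?_)
  · obtain ⟨k, a, -, hxa⟩ := (localizedSubalgebra_top hq).ge (Algebra.mem_top (x := x))
    refine ⟨k, a, mem_centralizer_singleton_iff.2 ((commute_toGL_iff hq).1 ?_), hxa⟩
    rw [← hxa]
    exact (mem_centralizer_singleton_iff.1 hx).mul_left
      ((commute_toGL_detM hq (toGL n q s)).symm.pow_left k)
  · rintro _ ⟨a, ha, rfl⟩
    exact mem_centralizer_singleton_iff.2 ((mem_centralizer_singleton_iff.1 ha).map (toGL n q))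
  · let u : (OqGL n q)ˣ := ⟨_, _, toGL_detM_mul_detInv n q, detInv_mul_toGL_detM n q⟩
    exact mem_centralizer_singleton_iff.2
      ((show Commute (u : OqGL n q) _ from (commute_toGL_detM hq _).symm).units_inv_left)

/-- The subalgebra `ℂ⟨σ₁, …, σₙ, σₙ⁻¹⟩` of the localization. -/
def sigmaAlgGL (n : ℕ) (q : ℂ) : Subalgebra ℂ (OqGL n q) :=
  Algebra.adjoin ℂ ({y | ∃ i, 1 ≤ i ∧ i ≤ n ∧ y = toGL n q (sigmaM n q i)} ∪ {detInv n q})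

theorem sigmaAlgGL_eq_localizedSubalgebra {n : ℕ} (hn : 1 ≤ n) {q : ℂ} (hq : q ≠ 0) :
    sigmaAlgGL n q = localizedSubalgebra hq (sigmaAlg n q) (detM_mem_sigmaAlg hn q) := by
  refine le_antisymm (Algebra.adjoin_le ?_) (localizedSubalgebra_le hq _ ?_ ?_)
  · rintro _ (⟨i, h1, hi, rfl⟩ | rfl)
    · exact toGL_mem_localizedSubalgebra hq _ (sigmaM_mem_sigmaAlg q h1 hi)
    · exact detInv_mem_localizedSubalgebra hq _
  · exact Subalgebra.map_le.2 <| sigmaAlg_le_iff.2 fun i h1 hi =>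
      Algebra.subset_adjoin (Or.inl ⟨i, h1, hi, rfl⟩)
  · exact Algebra.subset_adjoin (Or.inr rfl)

theorem isSymmetric_diagHom_of_mul_detM_pow_mem {n : ℕ} (hn : 1 ≤ n) {q : ℂ} {a : OqM n q} {k : ℕ}
    (h : a * detM n q ^ k ∈ sigmaAlg n q) : (diagHom n q a).IsSymmetric := by
  intro w
  have hdet := isSymmetric_diagHom (pow_mem (detM_mem_sigmaAlg hn q) k) w
  have ha := isSymmetric_diagHom h w
  rw [map_mul, map_mul, hdet] at ha
  refine mul_right_cancel₀ ?_ ha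
  rw [map_pow]
  exact pow_ne_zero k (diagHom_detM_ne_zero n q)

theorem centralizer_GL_iff {n : ℕ} (hn : 1 ≤ n) {q : ℂ} (hq0 : q ≠ 0)
    (hq : ∀ m : ℕ, 0 < m → q ^ m ≠ 1) :
    Subalgebra.centralizer ℂ {sigmaM n q 1} = sigmaAlg n q ↔
      Subalgebra.centralizer ℂ {toGL n q (sigmaM n q 1)} = sigmaAlgGL n q := by
  constructor
  · intro h
    rw [centralizer_toGL hq0, sigmaAlgGL_eq_localizedSubalgebra hn hq0]
    congr
  · intro h
    rw [sigmaAlgGL_eq_localizedSubalgebra hn hq0] at h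
    have hmem (a : OqM n q) : toGL n q a ∈ localizedSubalgebra hq0 (sigmaAlg n q)
        (detM_mem_sigmaAlg hn q) ↔ Commute a (sigmaM n q 1) := by
      rw [← h, mem_centralizer_singleton_iff, commute_toGL_iff hq0]
    refine (centralizer_eq_sigmaAlg_iff hq0 hq).2 ⟨fun i h1 hi => ?_, fun a ha => ?_⟩
    · exact (hmem _).1 (toGL_mem_localizedSubalgebra hq0 _ (sigmaM_mem_sigmaAlg q h1 hi))
    · obtain ⟨k, hk⟩ := exists_mul_detM_pow_mem hq0 _ ((hmem a).2 ha)
      exact isSymmetric_diagHom_of_mul_detM_pow_mem hn hk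

/-! ### Degrees -/

section Degrees

variable {K R S : Type*} [CommSemiring K] [Ring R] [Algebra K R] [Ring S] [Algebra K S]

theorem coeff_monomial_mul_sub_self_natDegree_add {n : ℕ} (hn : 1 ≤ n) (c : R) (g : R[X]) :
    (monomial n c * g - g).coeff (g.natDegree + n) = c * g.leadingCoeff := by
  rw [coeff_sub, coeff_monomial_mul, coeff_natDegree,
    coeff_eq_zero_of_natDegree_lt (Nat.lt_add_of_pos_right hn), sub_zero]

theorem coeff_monomial_mul_sub_self_natTrailingDegree {n : ℕ} (hn : 1 ≤ n) (c : R) (g : R[X]) :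
    (monomial n c * g - g).coeff g.natTrailingDegree = -g.trailingCoeff := by
  have h0 : (X ^ n * g).coeff g.natTrailingDegree = 0 := by
    rw [coeff_X_pow_mul', ite_eq_right_iff]
    exact fun h => coeff_eq_zero_of_lt_natTrailingDegree (by omega)
  rw [coeff_sub, ← C_mul_X_pow_eq_monomial, mul_assoc, coeff_C_mul, h0, mul_zero, zero_sub,
    trailingCoeff]

/-- `a` is homogeneous of degree `d` for the grading that is encoded by the homomorphism
`γ : R → R[X]`, which multiplies an element of degree `d` by `X ^ d`. -/
def IsHomog (γ : R →ₐ[K] R[X]) (d : ℕ) (a : R) : Prop := γ a = monomial d a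

/-- The degrees of the homogeneous components of `a`, for the grading encoded by `γ`, lie in `s`. -/
def HasDegreesIn (γ : R →ₐ[K] R[X]) (s : Set ℕ) (a : R) : Prop :=
  ∀ k, (γ a).coeff k ≠ 0 → k ∈ s

variable {γ : R →ₐ[K] R[X]} {d e : ℕ} {a b : R}

namespace IsHomog

theorem zero : IsHomog γ d 0 := by
  rw [IsHomog, map_zero, map_zero]

theorem one : IsHomog γ 0 1 := by
  rw [IsHomog, map_one, monomial_zero_one]

theorem add (ha : IsHomog γ d a) (hb : IsHomog γ d b) : IsHomog γ d (a + b) := by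
  rw [IsHomog, map_add, ha, hb, map_add]

theorem sub (ha : IsHomog γ d a) (hb : IsHomog γ d b) : IsHomog γ d (a - b) := by
  rw [IsHomog, map_sub, ha, hb, map_sub]

theorem smul (ha : IsHomog γ d a) (c : K) : IsHomog γ d (c • a) := by
  rw [IsHomog, map_smul, ha, smul_monomial]

theorem mul (ha : IsHomog γ d a) (hb : IsHomog γ e b) : IsHomog γ (d + e) (a * b) := by
  rw [IsHomog, map_mul, ha, hb, monomial_mul_monomial]

theorem pow (ha : IsHomog γ d a) (k : ℕ) : IsHomog γ (d * k) (a ^ k) := by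
  rw [IsHomog, map_pow, ha, monomial_pow]

theorem sum {ι : Type*} {s : Finset ι} {f : ι → R} (hf : ∀ i ∈ s, IsHomog γ d (f i)) :
    IsHomog γ d (∑ i ∈ s, f i) := by
  rw [IsHomog, map_sum, map_sum]
  exact Finset.sum_congr rfl hf

theorem prod_ofFn {t : ℕ} {f : Fin t → R} (hf : ∀ i, IsHomog γ 1 (f i)) :
    IsHomog γ t (List.ofFn f).prod := by
  induction t with
  | zero => exact one
  | succ t ih =>
    rw [List.ofFn_succ, List.prod_cons]
    have h := (hf 0).mul (ih fun i => hf i.succ)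
    rwa [add_comm] at h

theorem map {δ : S →ₐ[K] S[X]} {f : R →ₐ[K] S} (hf : δ.comp f = (mapAlgHom f).comp γ)
    (ha : IsHomog γ d a) : IsHomog δ d (f a) := by
  have h : δ (f a) = mapAlgHom f (γ a) := DFunLike.congr_fun hf a
  rw [IsHomog, h, ha]
  exact map_monomial _

theorem hasDegreesIn (ha : IsHomog γ d a) {s : Set ℕ} (hd : d ∈ s) : HasDegreesIn γ s a := by
  intro k hk
  rw [ha, coeff_monomial] at hk
  exact (ite_ne_right_iff.1 hk).1 ▸ hd

end IsHomog

namespace HasDegreesIn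

variable {s : Set ℕ} {N M : ℕ}

theorem add (ha : HasDegreesIn γ s a) (hb : HasDegreesIn γ s b) : HasDegreesIn γ s (a + b) := by
  intro k hk
  by_cases h : (γ a).coeff k = 0
  · exact hb k (by rwa [map_add, coeff_add, h, zero_add] at hk)
  · exact ha k h

theorem sub (ha : HasDegreesIn γ s a) (hb : HasDegreesIn γ s b) : HasDegreesIn γ s (a - b) := by
  rw [sub_eq_add_neg]
  exact ha.add fun k hk => hb k (by simpa using hk)

theorem sum {ι : Type*} {t : Finset ι} {f : ι → R} (hf : ∀ i ∈ t, HasDegreesIn γ s (f i)) :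
    HasDegreesIn γ s (∑ i ∈ t, f i) :=
  Finset.sum_induction _ _ (fun _ _ => add) (fun k hk => by simp at hk) hf

theorem mul_isHomog (ha : HasDegreesIn γ (Set.Ico N M) a) (hb : IsHomog γ e b) :
    HasDegreesIn γ (Set.Ico (N + e) (M + e)) (a * b) := by
  intro k hk
  rw [map_mul, hb, ← C_mul_X_pow_eq_monomial, ← mul_assoc, coeff_mul_X_pow'] at hk
  obtain ⟨hek, hk⟩ := ite_ne_right_iff.1 hk
  rw [coeff_mul_C] at hk
  have := ha _ (left_ne_zero_of_mul hk)
  simp only [Set.mem_Ico] at this ⊢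
  omega

theorem isHomog_mul (ha : IsHomog γ e a) (hb : HasDegreesIn γ (Set.Ico N M) b) :
    HasDegreesIn γ (Set.Ico (N + e) (M + e)) (a * b) := by
  intro k hk
  rw [map_mul, ha, ← C_mul_X_pow_eq_monomial, mul_assoc, X_pow_mul, coeff_C_mul,
    coeff_mul_X_pow'] at hk
  obtain ⟨hek, hk⟩ := ite_ne_right_iff.1 (right_ne_zero_of_mul hk)
  have := hb _ hk
  simp only [Set.mem_Ico] at this ⊢
  omega

-- With `g = γ b`, the image of `(c - 1) * b` under `γ` is `c * X ^ n * g - g`, whose degrees spread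
-- from the lowest degree of `g` up to `n` more than its highest one.
theorem eq_zero_of_sub_one_mul [NoZeroDivisors R] (hγ : Function.Injective γ) {n : ℕ}
    (hn : 1 ≤ n) {c : R} (hc : IsHomog γ n c) (hc0 : c ≠ 0)
    (h : HasDegreesIn γ (Set.Ico N (N + n)) ((c - 1) * b)) : b = 0 := by
  by_contra hb
  have hg : γ b ≠ 0 := (map_ne_zero_iff γ hγ).2 hb
  have hexp : γ ((c - 1) * b) = monomial n c * γ b - γ b := by
    rw [map_mul, map_sub, map_one, hc, sub_mul, one_mul]
  have htop := h ((γ b).natDegree + n) <| by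
    rw [hexp, coeff_monomial_mul_sub_self_natDegree_add hn]
    exact mul_ne_zero hc0 (leadingCoeff_ne_zero.2 hg)
  have hbot := h (γ b).natTrailingDegree <| by
    rw [hexp, coeff_monomial_mul_sub_self_natTrailingDegree hn]
    exact neg_ne_zero.2 (mt trailingCoeff_eq_zero.1 hg)
  have hle := natTrailingDegree_le_natDegree (γ b)
  simp only [Set.mem_Ico] at htop hbot
  omega

end HasDegreesIn

end Degrees

/-- The homomorphism `x i j ↦ x i j * X`, which encodes the grading of `OqM n q` by degree. -/
def degHom (n : ℕ) (q : ℂ) : OqM n q →ₐ[ℂ] (OqM n q)[X] :=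
  OqM.lift ((genX n q).map (monomial 1)) <| by
    have h := isQMatrix_genX n q
    refine ⟨fun _ _ _ _ hik hjl => ?_, fun _ _ _ hjl => ?_, fun _ _ _ hik => ?_,
      fun _ _ _ _ hik hlj => ?_⟩
    · simp only [Matrix.map_apply, monomial_mul_monomial, h.diag hik hjl, smul_monomial, map_add]
    · simp only [Matrix.map_apply, monomial_mul_monomial, h.row hjl, smul_monomial]
    · simp only [Matrix.map_apply, monomial_mul_monomial, h.col hik, smul_monomial]
    · simp only [Matrix.map_apply, monomial_mul_monomial, h.anti hik hlj]

/-- The homomorphism `x i ↦ x i * X`, which encodes the grading of the polynomial ring by total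
degree. -/
def polyDegHom (n : ℕ) : MvPolynomial (Fin n) ℂ →ₐ[ℂ] (MvPolynomial (Fin n) ℂ)[X] :=
  MvPolynomial.aeval fun i => monomial 1 (MvPolynomial.X i)

theorem polyDegHom_injective (n : ℕ) : Function.Injective (polyDegHom n) := by
  have h : ((Polynomial.aeval (1 : MvPolynomial (Fin n) ℂ)).restrictScalars ℂ).comp
      (polyDegHom n) = AlgHom.id ℂ _ := by
    ext1 i
    simp [polyDegHom]
  exact Function.LeftInverse.injective (DFunLike.congr_fun h)

theorem polyDegHom_comp_rename {n : ℕ} (w : Fin n → Fin n) :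
    (polyDegHom n).comp (MvPolynomial.rename w) =
      (mapAlgHom (MvPolynomial.rename w)).comp (polyDegHom n) := by
  ext1 i
  simp [polyDegHom]

variable {n : ℕ} {q : ℂ}

theorem isHomog_genX (i j : Fin n) : IsHomog (degHom n q) 1 (genX n q i j) :=
  OqM.lift_genX _ _ i j

theorem polyDegHom_comp_diagHom :
    (polyDegHom n).comp (diagHom n q) = (mapAlgHom (diagHom n q)).comp (degHom n q) := by
  refine (isPresentedOn_genX n q).hom_ext fun i j => ?_
  rw [AlgHom.comp_apply, AlgHom.comp_apply, isHomog_genX, diagHom_genX]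
  by_cases h : i = j
  · subst h
    simp [polyDegHom, diagHom_genX]
  · simp [diagHom_genX, h]

theorem isHomog_sigmaM (t : ℕ) : IsHomog (degHom n q) t (sigmaM n q t) := by
  rw [sigmaM, qSigma]
  refine IsHomog.sum fun I _ => ?_
  rw [qMinor, qDet]
  exact IsHomog.sum fun s _ => (IsHomog.prod_ofFn fun a => isHomog_genX _ _).smul _

theorem isHomog_detM : IsHomog (degHom n q) n (detM n q) := by
  rw [← sigmaM_self]
  exact isHomog_sigmaM n

theorem isHomog_coeff_degHom (a : OqM n q) (d : ℕ) :
    IsHomog (degHom n q) d ((degHom n q a).coeff d) := by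
  induction a using OqM.induction generalizing d with
  | one =>
    rw [map_one, coeff_one]
    split_ifs with h
    · exact h ▸ IsHomog.one
    · exact IsHomog.zero
  | smul c a ih => rw [map_smul, coeff_smul]; exact (ih d).smul c
  | add a b iha ihb => rw [map_add, coeff_add]; exact (iha d).add (ihb d)
  | mul i j a ih =>
    rw [map_mul, isHomog_genX]
    cases d with
    | zero => simpa [mul_coeff_zero] using IsHomog.zero
    | succ d =>
      rw [coeff_monomial_mul, add_comm]
      exact (isHomog_genX i j).mul (ih d)

theorem eval_one_degHom (a : OqM n q) : (degHom n q a).eval 1 = a := by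
  induction a using OqM.induction with
  | one => simp
  | smul c a ih => rw [map_smul, eval_smul, ih]
  | add a b iha ihb => rw [map_add, eval_add, iha, ihb]
  | mul i j a ih =>
    rw [map_mul, isHomog_genX, ← C_mul_X_pow_eq_monomial, pow_one, mul_assoc, X_mul, eval_C_mul,
      eval_mul_X, mul_one, ih]

theorem degHom_injective : Function.Injective (degHom n q) :=
  Function.LeftInverse.injective eval_one_degHom

theorem sum_coeff_degHom (a : OqM n q) :
    ∑ d ∈ (degHom n q a).support, (degHom n q a).coeff d = a := by
  conv_rhs => rw [← eval_one_degHom a, eval_eq_sum, Polynomial.sum_def]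
  simp

theorem commute_coeff_degHom {e : ℕ} {a s : OqM n q} (hs : IsHomog (degHom n q) e s)
    (ha : Commute a s) (d : ℕ) : Commute ((degHom n q a).coeff d) s := by
  have h := congrArg (fun g => g.coeff (d + e)) (ha.map (degHom n q)).eq
  rw [hs] at h
  simpa only [commute_iff_eq, coeff_mul_monomial, coeff_monomial_mul] using h

/-! ### The quotient `OqSL` -/

theorem toSL_surjective : Function.Surjective (toSL n q) := RingCon.mkₐ_surjective _

theorem mem_span_singleton_iff_of_commute {R : Type*} [Ring R] {c : R} (hc : ∀ x, Commute c x)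
    {a : R} : a ∈ TwoSidedIdeal.span {c} ↔ c ∣ a := by
  refine ⟨fun h => ?_, ?_⟩
  · induction h using TwoSidedIdeal.span_induction with
    | mem x hx => exact dvd_of_eq hx.symm
    | zero => exact dvd_zero c
    | add x y _ _ hx hy => exact dvd_add hx hy
    | neg x _ hx => exact (dvd_neg).2 hx
    | left_absorb r x _ hx =>
      obtain ⟨y, rfl⟩ := hx
      exact ⟨r * y, by rw [← mul_assoc, ← (hc r).eq, mul_assoc]⟩
    | right_absorb r x _ hx => exact hx.mul_right r
  · rintro ⟨b, rfl⟩
    exact TwoSidedIdeal.mul_mem_right _ _ _ (TwoSidedIdeal.subset_span rfl)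

theorem toSL_eq_iff (hq : q ≠ 0) {a b : OqM n q} :
    toSL n q a = toSL n q b ↔ detM n q - 1 ∣ a - b := by
  rw [← mem_span_singleton_iff_of_commute fun x =>
    (commute_detM hq x).sub_left (Commute.one_left x), ← TwoSidedIdeal.rel_iff]
  exact RingCon.eq _

theorem toSL_detM (hq : q ≠ 0) : toSL n q (detM n q) = 1 := by
  rw [← map_one (toSL n q), toSL_eq_iff hq]

theorem eq_of_toSL_eq (hn : 1 ≤ n) (hq : q ≠ 0) {N : ℕ} {a b : OqM n q}
    (hab : toSL n q a = toSL n q b)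
    (h : HasDegreesIn (degHom n q) (Set.Ico N (N + n)) (a - b)) : a = b := by
  have hdom := OqM.noZeroDivisors n hq
  obtain ⟨c, hc⟩ := (toSL_eq_iff hq).1 hab
  rw [hc] at h
  rw [← sub_eq_zero, hc, h.eq_zero_of_sub_one_mul degHom_injective hn isHomog_detM
    (detM_ne_zero n q), mul_zero]

theorem commute_of_commute_toSL (hn : 1 ≤ n) (hq : q ≠ 0) {e N : ℕ} {a s : OqM n q}
    (ha : HasDegreesIn (degHom n q) (Set.Ico N (N + n)) a) (hs : IsHomog (degHom n q) e s)
    (h : Commute (toSL n q a) (toSL n q s)) : Commute a s := by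
  refine eq_of_toSL_eq (N := N + e) hn hq ?_ ?_
  · simpa only [map_mul] using h.eq
  · rw [add_right_comm]
    exact (ha.mul_isHomog hs).sub (ha.isHomog_mul hs)

-- Multiplying the component of degree `d` by a suitable power of `det_q`, which becomes `1` in
-- `OqSL`, moves its degree into any window of length `n` that begins at a multiple of `n` and does
-- not lie below `d`.
theorem exists_lift_hasDegreesIn (hn : 1 ≤ n) (hq : q ≠ 0) (x : OqSL n q) :
    ∃ N a, toSL n q a = x ∧ HasDegreesIn (degHom n q) (Set.Ico N (N + n)) a := by
  obtain ⟨b, rfl⟩ := toSL_surjective x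
  set N := (degHom n q b).natDegree / n
  refine ⟨n * N, ∑ d ∈ (degHom n q b).support, (degHom n q b).coeff d * detM n q ^ (N - d / n),
    ?_, HasDegreesIn.sum fun d hd => ?_⟩
  · simp only [map_sum, map_mul, map_pow, toSL_detM hq, one_pow, mul_one]
    rw [← map_sum, sum_coeff_degHom]
  · refine ((isHomog_coeff_degHom b d).mul (isHomog_detM.pow _)).hasDegreesIn ?_
    have hdN : d / n ≤ N := Nat.div_le_div_right (le_natDegree_of_mem_supp d hd)
    have hdiv := Nat.div_add_mod d n
    have hmod := Nat.mod_lt d hn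
    have hshift : n * (d / n) + n * (N - d / n) = n * N := by
      rw [← mul_add, Nat.add_sub_cancel' hdN]
    rw [Set.mem_Ico]
    omega

theorem centralizer_toSL (hn : 1 ≤ n) (hq : q ≠ 0) {e : ℕ} {s : OqM n q}
    (hs : IsHomog (degHom n q) e s) : Subalgebra.centralizer ℂ {toSL n q s} =
      (Subalgebra.centralizer ℂ {s}).map (toSL n q) := by
  ext x
  rw [mem_centralizer_singleton_iff, Subalgebra.mem_map]
  constructor
  · intro hx
    obtain ⟨N, a, rfl, ha⟩ := exists_lift_hasDegreesIn hn hq x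
    exact ⟨a, mem_centralizer_singleton_iff.2 (commute_of_commute_toSL hn hq ha hs hx), rfl⟩
  · rintro ⟨a, ha, rfl⟩
    exact (mem_centralizer_singleton_iff.1 ha).map (toSL n q)

/-- The subalgebra of `OqSL n q` generated by the images of `σ₁, …, σₙ₋₁`. -/
def sigmaAlgSL (n : ℕ) (q : ℂ) : Subalgebra ℂ (OqSL n q) :=
  Algebra.adjoin ℂ {y | ∃ i, 1 ≤ i ∧ i < n ∧ y = toSL n q (sigmaM n q i)}

theorem map_sigmaAlg_toSL (hq : q ≠ 0) : (sigmaAlg n q).map (toSL n q) = sigmaAlgSL n q := by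
  refine le_antisymm (Subalgebra.map_le.2 (sigmaAlg_le_iff.2 fun i h1 hi => ?_))
    (Algebra.adjoin_le ?_)
  · rw [Subalgebra.mem_comap]
    rcases hi.lt_or_eq with hi | rfl
    · exact Algebra.subset_adjoin ⟨i, h1, hi, rfl⟩
    · rw [sigmaM_self, toSL_detM hq]
      exact one_mem _
  · rintro _ ⟨i, h1, hi, rfl⟩
    exact ⟨_, sigmaM_mem_sigmaAlg q h1 hi.le, rfl⟩

theorem exists_rename_diagHom_sub_eq (hn : 1 ≤ n) (hq : q ≠ 0) {a : OqM n q}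
    (h : toSL n q a ∈ (sigmaAlg n q).map (toSL n q)) (w : Equiv.Perm (Fin n)) :
    ∃ b, MvPolynomial.rename w (diagHom n q a) - diagHom n q a =
      (diagHom n q (detM n q) - 1) * b := by
  obtain ⟨s, hs, hsa⟩ := h
  obtain ⟨c, hc⟩ := (toSL_eq_iff hq).1 hsa.symm
  have ha : diagHom n q a = diagHom n q s + (diagHom n q (detM n q) - 1) * diagHom n q c := by
    rw [eq_add_of_sub_eq' hc, map_add, map_mul, map_sub, map_one]
  refine ⟨MvPolynomial.rename w (diagHom n q c) - diagHom n q c, ?_⟩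
  rw [ha, map_add, map_mul, map_sub, map_one, isSymmetric_diagHom hs w,
    isSymmetric_diagHom (detM_mem_sigmaAlg hn q) w]
  ring

theorem isSymmetric_diagHom_of_toSL_mem (hn : 1 ≤ n) (hq : q ≠ 0) {d : ℕ} {a : OqM n q}
    (ha : IsHomog (degHom n q) d a) (h : toSL n q a ∈ (sigmaAlg n q).map (toSL n q)) :
    (diagHom n q a).IsSymmetric := by
  intro w
  obtain ⟨b, hb⟩ := exists_rename_diagHom_sub_eq hn hq h w
  have hD : IsHomog (polyDegHom n) d (diagHom n q a) := ha.map polyDegHom_comp_diagHom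
  have hdiff := (hD.map (polyDegHom_comp_rename w)).sub hD
  have hdeg := hdiff.hasDegreesIn (Set.left_mem_Ico.2 (Nat.lt_add_of_pos_right hn))
  rw [hb] at hdeg
  rw [← sub_eq_zero, hb, hdeg.eq_zero_of_sub_one_mul (polyDegHom_injective n) hn
    (isHomog_detM.map polyDegHom_comp_diagHom) (diagHom_detM_ne_zero n q), mul_zero]

theorem isSymmetric_diagHom_of_centralizer_toSL (hn : 1 ≤ n) (hq : q ≠ 0)
    (h : Subalgebra.centralizer ℂ {toSL n q (sigmaM n q 1)} = (sigmaAlg n q).map (toSL n q))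
    {a : OqM n q} (ha : Commute a (sigmaM n q 1)) : (diagHom n q a).IsSymmetric := by
  rw [← sum_coeff_degHom a, map_sum]
  refine (MvPolynomial.symmetricSubalgebra (Fin n) ℂ).sum_mem fun d _ =>
    isSymmetric_diagHom_of_toSL_mem hn hq (isHomog_coeff_degHom a d) ?_
  rw [← h, mem_centralizer_singleton_iff]
  exact (commute_coeff_degHom (isHomog_sigmaM 1) ha d).map (toSL n q)

theorem centralizer_SL_iff (hn : 1 ≤ n) (hq0 : q ≠ 0) (hq : ∀ m : ℕ, 0 < m → q ^ m ≠ 1) :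
    Subalgebra.centralizer ℂ {sigmaM n q 1} = sigmaAlg n q ↔
      Subalgebra.centralizer ℂ {toSL n q (sigmaM n q 1)} = sigmaAlgSL n q := by
  rw [← map_sigmaAlg_toSL hq0]
  refine ⟨fun h => by rw [centralizer_toSL hn hq0 (isHomog_sigmaM 1), h], fun h =>
    (centralizer_eq_sigmaAlg_iff hq0 hq).2 ⟨fun i h1 hi => ?_, fun a ha =>
      isSymmetric_diagHom_of_centralizer_toSL hn hq0 h ha⟩⟩
  have hσ : toSL n q (sigmaM n q i) ∈ Subalgebra.centralizer ℂ {toSL n q (sigmaM n q 1)} :=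
    h ▸ ⟨_, sigmaM_mem_sigmaAlg q h1 hi, rfl⟩
  exact commute_of_commute_toSL hn hq0
    ((isHomog_sigmaM i).hasDegreesIn (Set.left_mem_Ico.2 (Nat.lt_add_of_pos_right hn)))
    (isHomog_sigmaM 1) (mem_centralizer_singleton_iff.1 hσ)

end QuantumMatrices

end

theorem proposition3 (n : ℕ) (hn : 1 ≤ n) (q : ℂ) (hq0 : q ≠ 0)
    (hq : ∀ m : ℕ, 0 < m → q ^ m ≠ 1) :
    List.TFAE [
      Subalgebra.centralizer ℂ {QuantumMatrices.sigmaM n q 1} =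
        Algebra.adjoin ℂ {y | ∃ i, 1 ≤ i ∧ i ≤ n ∧ y = QuantumMatrices.sigmaM n q i},
      Subalgebra.centralizer ℂ {QuantumMatrices.toGL n q (QuantumMatrices.sigmaM n q 1)} =
        Algebra.adjoin ℂ
          ({y | ∃ i, 1 ≤ i ∧ i ≤ n ∧
              y = QuantumMatrices.toGL n q (QuantumMatrices.sigmaM n q i)} ∪
            {QuantumMatrices.detInv n q}),
      Subalgebra.centralizer ℂ {QuantumMatrices.toSL n q (QuantumMatrices.sigmaM n q 1)} =
        Algebra.adjoin ℂ {y | ∃ i, 1 ≤ i ∧ i < n ∧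
          y = QuantumMatrices.toSL n q (QuantumMatrices.sigmaM n q i)}] := by
  tfae_have 1 ↔ 2 := QuantumMatrices.centralizer_GL_iff hn hq0 hq
  tfae_have 1 ↔ 3 := QuantumMatrices.centralizer_SL_iff hn hq0 hq
  tfae_finish
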